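/- Fix $\beta>0$ and a budget $b\ge 0$. An outcome is a pair $(a,t)$ with $a\in[0,1]$ (allocation probability) and $t\in\mathbb R$ (payment). For a set $X$ of outcomes let $X_b=\{(a,t)\in X: t\le b\}$ and, for a valuation $w\in[0,\beta]$, let $Ch(X;w)=\{(a,t)\in X: wa-t\ge wa'-t'\ \forall (a',t')\in X\}$. Write $X\rhd_w Y$ if $wa-t\ge wa'-t'$ for all $(a,t)\in X$ and $(a',t')\in Y$, with strict inequality for at least one such pair. The type space is $V=\{(v_1,v_2)\in[0,\beta]^2: v_1\ge v_2\}$ ($v_1$ is the agent's value, $v_2$ the principal's), and for $v\in V$ $$Ch(X;v)=\begin{cases}Ch(X;v_2)&\text{if } Ch(X;v_2)\rhd_{v_1}Ch(X_b;v_1),\\ Ch(X_b;v_1)&\text{otherwise.}\end{cases}$$ A mechanism is a pair $q:V\to[0,1]$, $p:V\to\mathbb R$, with range $R(q,p)=\{(q(v),p(v)):v\in V\}$. It is incentive compatible (IC) if $(q(v),p(v))\in Ch(R(q,p);v)$ for all $v\in V$, and individually rational (IR) if $(0,0)\in R(q,p)$. Types have a joint probability density $f$ on $V$, the expected revenue of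 $(q,p)$ is $\int_V p(v)f(v)\,dv$, and a mechanism is optimal if it is IC and IR and its expected revenue is at least that of every IC and IR mechanism. Let $F_1$ be the marginal cdf of $v_1$. A mechanism is POST-1 if for some $\kappa_1\in[0,b]$ it assigns $(0,0)$ to types with $v_1\le\kappa_1$ and $(1,\kappa_1)$ to all other types. It is POST-2 if for some $\kappa_1,\kappa_2$ with $b\le\kappa_1\le\kappa_2\le\beta$ and $\kappa_1>0$ it assigns $(0,0)$ to types with $v_1<\kappa_1$, $\bigl(1,\,b+\kappa_2(1-\tfrac{b}{\kappa_1})\bigr)$ to types with $v_2>\kappa_2$, and $\bigl(\tfrac{b}{\kappa_1},b\bigr)$ to all other types. Theorem. If $x\mapsto x(1-F_1(x))$ is strictly concave on $[0,\beta]$, then there exists an optimal mechanism that is either a POST-1 or a POST-2 mechanism. -/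

import Mathlib

open MeasureTheory

namespace PrincipalAgent

/-- An outcome `(a, t)`: allocation probability `a` and payment `t` made to the seller.
Feasibility `a ∈ [0, 1]` is imposed in `Mechanism`. -/
abbrev Outcome : Type := ℝ × ℝ

/-- Quasilinear payoff `w a - t` from the outcome `(a, t)` at valuation `w`. -/
def payoff (w : ℝ) (z : Outcome) : ℝ := w * z.1 - z.2

/-- The budget set `X_b`: the outcomes in `X` with payment at most `b`. -/
def budgetSet (b : ℝ) (X : Set Outcome) : Set Outcome := {z ∈ X | z.2 ≤ b}

/-- `Ch(X; w)` for a single valuation `w`: the payoff-maximal outcomes of `X`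
(possibly none, if the supremum is not attained). -/
def choice (X : Set Outcome) (w : ℝ) : Set Outcome :=
  {z ∈ X | ∀ z' ∈ X, payoff w z' ≤ payoff w z}

/-- `X ⊵_w Y`: every outcome of `X` is weakly better than every outcome of `Y`. -/
def WeaklyBetter (w : ℝ) (X Y : Set Outcome) : Prop :=
  ∀ x ∈ X, ∀ y ∈ Y, payoff w y ≤ payoff w x

/-- `X ▷_w Y`: `X ⊵_w Y`, with strict inequality for at least one pair of outcomes. -/
def StrictlyBetter (w : ℝ) (X Y : Set Outcome) : Prop :=
  WeaklyBetter w X Y ∧ ∃ x ∈ X, ∃ y ∈ Y, payoff w y < payoff w x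

open Classical in
/-- `Ch(X; v)` for a type `v = (v₁, v₂)`: the principal's choice `Ch(X; v₂)` from `X` if the agent
(valuation `v₁`) ranks it strictly above her own choice `Ch(X_b; v₁)` from the budget set, and
`Ch(X_b; v₁)` otherwise. -/
noncomputable def pairChoice (b : ℝ) (X : Set Outcome) (v : ℝ × ℝ) : Set Outcome :=
  if StrictlyBetter v.1 (choice X v.2) (choice (budgetSet b X) v.1) then choice X v.2
  else choice (budgetSet b X) v.1

/-- The type space `V = {(v₁, v₂) ∈ [0, β]² : v₁ ≥ v₂}` (agent's value first). -/
def typeSpace (β : ℝ) : Set (ℝ × ℝ) :=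
  {v | v.1 ∈ Set.Icc 0 β ∧ v.2 ∈ Set.Icc 0 β ∧ v.2 ≤ v.1}

/-- A (direct) mechanism on the type space: allocation rule `q` and payment rule `p`.
Both are functions on the plane, of which only the values on `typeSpace β` are ever used. -/
structure Mechanism (β : ℝ) where
  /-- allocation rule -/
  q : ℝ × ℝ → ℝ
  /-- payment rule -/
  p : ℝ × ℝ → ℝ
  q_mem : ∀ v ∈ typeSpace β, q v ∈ Set.Icc (0 : ℝ) 1

namespace Mechanism

variable {β : ℝ}

/-- The outcome assigned to the type `v`. -/
def outcome (M : Mechanism β) (v : ℝ × ℝ) : Outcome := (M.q v, M.p v)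

/-- The range `R(q, p)` of a mechanism. -/
def range (M : Mechanism β) : Set Outcome := M.outcome '' typeSpace β

/-- Incentive compatibility with respect to the budget-dependent choice rule. -/
def IC (b : ℝ) (M : Mechanism β) : Prop :=
  ∀ v ∈ typeSpace β, M.outcome v ∈ pairChoice b M.range v

/-- Individual rationality: the outcome `(0, 0)` is available. -/
def IR (M : Mechanism β) : Prop := ((0, 0) : Outcome) ∈ M.range

/-- Expected revenue under the joint density `f`. -/
noncomputable def revenue (f : ℝ × ℝ → ℝ) (M : Mechanism β) : ℝ :=
  ∫ v in typeSpace β, M.p v * f v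

/-- Optimality: the mechanism is IC and IR, its expected revenue is a genuine (convergent)
integral, and it is at least the expected revenue of every IC and IR mechanism. -/
def IsOptimal (b : ℝ) (f : ℝ × ℝ → ℝ) (M : Mechanism β) : Prop :=
  M.IC b ∧ M.IR ∧ IntegrableOn (fun v => M.p v * f v) (typeSpace β) ∧
    ∀ M' : Mechanism β, M'.IC b → M'.IR → M'.revenue f ≤ M.revenue f

/-- POST-1 mechanism: a posted price `κ₁ ∈ [0, b]` for the agent. -/
def IsPost1 (b : ℝ) (M : Mechanism β) : Prop :=
  ∃ κ₁ ∈ Set.Icc 0 b, ∀ v ∈ typeSpace β,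
    M.outcome v = if v.1 ≤ κ₁ then (0, 0) else (1, κ₁)

/-- POST-2 mechanism, with cutoffs `b ≤ κ₁ ≤ κ₂ ≤ β`. The clause `0 < κ₁` makes the quotient
`b / κ₁` meaningful; it is automatic when `b > 0`. -/
def IsPost2 (b : ℝ) (M : Mechanism β) : Prop :=
  ∃ κ₁ ∈ Set.Icc b β, ∃ κ₂ ∈ Set.Icc b β, 0 < κ₁ ∧ κ₁ ≤ κ₂ ∧ ∀ v ∈ typeSpace β,
    M.outcome v =
      if v.1 < κ₁ then (0, 0)
      else if κ₂ < v.2 then (1, b + κ₂ * (1 - b / κ₁))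
      else (b / κ₁, b)

end Mechanism

/-- `f` is a probability density (with respect to Lebesgue measure) on the type space. -/
structure IsJointDensity (β : ℝ) (f : ℝ × ℝ → ℝ) : Prop where
  nonneg : ∀ v ∈ typeSpace β, 0 ≤ f v
  integrable : IntegrableOn f (typeSpace β)
  integral_eq_one : ∫ v in typeSpace β, f v = 1

/-- The marginal cdf `F₁(x) = P(v₁ ≤ x)` of the agent's valuation. -/
noncomputable def marginalCDF₁ (β : ℝ) (f : ℝ × ℝ → ℝ) (x : ℝ) : ℝ :=
  ∫ v in typeSpace β ∩ {v | v.1 ≤ x}, f v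

end PrincipalAgent

/-! Incentive compatibility splits the types. A type paying at most `b` gets a best budget outcome
for `v.1`; a type paying more gets a best outcome of the whole range for `v.2`. Payments are
therefore dominated by a schedule in `v.1` capped at `b`, plus a schedule in `v.2` for the excess,
and each schedule can be optimised separately.

Suppose `b > 0` and some payment exceeds `b`. Let `l` be the infimum of `v.2` over such types, `u`
the agent's indirect utility, and `a = (b + u l) / l`, so that `(a, b)` gives valuation `l` exactly
`u l`. Every outcome costing more than `b` has allocation at least `a`, and its excess payment is at
most `v.2` times its excess allocation (`IC.isPrincipalBase_sInf`). The agents' schedule, completed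
by `(a, b)` at `l`, is a mixture of posted prices; as the revenue curve of `v.1` is concave, Jensen
replaces it by the single price `b / a`. The principals' schedule sells at most `1 - a` at prices in
`[l, β]`, so it earns at most `1 - a` times the best revenue `κ₂ * tail κ₂` there. With `κ₁ = b / a
≤ l ≤ κ₂` the sum is exactly a POST-2 revenue.

If no payment exceeds `b`, Jensen alone gives a POST-1 bound; if `b = 0`, only the principals' part
remains. An optimum exists since tails are continuous and the cutoffs range over compact sets.
Schedules need not be differentiable, so they are compared with step functions on uniform grids,
with an error that vanishes with the mesh. -/

namespace PrincipalAgent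

/-! ### Revealed preference and consequences of incentive compatibility -/

/-- Revealed preference: payoff-maximal outcomes at two valuations bound each other's payments. -/
theorem choice_payment_bounds {X : Set Outcome} {w w' : ℝ} {z z' : Outcome}
    (hz : z ∈ choice X w) (hz' : z' ∈ choice X w') :
    w * (z'.1 - z.1) ≤ z'.2 - z.2 ∧ z'.2 - z.2 ≤ w' * (z'.1 - z.1) := by
  have h1 := hz.2 z' hz'.1
  have h2 := hz'.2 z hz.1
  simp only [payoff] at h1 h2
  constructor <;> linarith

theorem choice_allocation_mono {X : Set Outcome} {w w' : ℝ} {z z' : Outcome}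
    (hz : z ∈ choice X w) (hz' : z' ∈ choice X w') (h : w < w') : z.1 ≤ z'.1 := by
  obtain ⟨h1, h2⟩ := choice_payment_bounds hz hz'
  by_contra hlt
  push Not at hlt
  nlinarith

theorem choice_payment_mono {X : Set Outcome} {w w' : ℝ} {z z' : Outcome}
    (hz : z ∈ choice X w) (hz' : z' ∈ choice X w') (hw : 0 ≤ w) (h : w < w') : z.2 ≤ z'.2 := by
  have h1 := (choice_payment_bounds hz hz').1
  have h2 := choice_allocation_mono hz hz' h
  nlinarith

theorem mk_zero_mem_typeSpace {β w : ℝ} (hw : w ∈ Set.Icc 0 β) : (w, 0) ∈ typeSpace β :=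
  ⟨hw, ⟨le_rfl, hw.1.trans hw.2⟩, hw.1⟩

namespace Mechanism

variable {β b : ℝ} {M : Mechanism β}

theorem outcome_mem_range {v : ℝ × ℝ} (hv : v ∈ typeSpace β) : M.outcome v ∈ M.range :=
  ⟨v, hv, rfl⟩

theorem zero_mem_budgetSet (hb : 0 ≤ b) (hIR : M.IR) :
    ((0, 0) : Outcome) ∈ budgetSet b M.range := ⟨hIR, hb⟩

/-- A type whose principal has valuation zero gets the agent's choice from the budget set. -/
theorem IC.outcome_mk_zero_mem (hIC : M.IC b) (hIR : M.IR) (hb : 0 ≤ b) {w : ℝ}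
    (hw : w ∈ Set.Icc 0 β) : M.outcome (w, 0) ∈ choice (budgetSet b M.range) w := by
  have h := hIC _ (mk_zero_mem_typeSpace hw)
  unfold pairChoice at h
  split_ifs at h with hs
  · exfalso
    obtain ⟨-, x, hx, y, hy, hlt⟩ := hs
    -- At valuation zero only the payment counts, so `(0, 0)` keeps the principal's choice within
    -- the budget, where it cannot beat the agent's own choice.
    have h0 := hx.2 _ hIR
    simp only [payoff] at h0
    have := hy.2 x ⟨hx.1, by linarith⟩
    exact absurd hlt (not_lt.mpr this)
  · exact h

/-- If the principal's choice prevails, the agent weakly prefers it to her own choice; being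
affordable, it is then itself a best budget outcome. -/
theorem IC.outcome_mem_of_payment_le (hIC : M.IC b) (hIR : M.IR) (hb : 0 ≤ b) {v : ℝ × ℝ}
    (hv : v ∈ typeSpace β) (hp : M.p v ≤ b) :
    M.outcome v ∈ choice (budgetSet b M.range) v.1 := by
  have h := hIC v hv
  unfold pairChoice at h
  split_ifs at h with hs
  · have hy := hIC.outcome_mk_zero_mem hIR hb hv.1
    exact ⟨⟨h.1, hp⟩, fun z hz => (hy.2 z hz).trans (hs.1 _ h _ hy)⟩
  · exact h

theorem IC.outcome_mem_of_lt_payment (hIC : M.IC b) {v : ℝ × ℝ}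
    (hv : v ∈ typeSpace β) (hp : b < M.p v) : M.outcome v ∈ choice M.range v.2 := by
  have h := hIC v hv
  unfold pairChoice at h
  split_ifs at h with hs
  · exact h
  · exact absurd h.1.2 (not_le.mpr hp)

/-- The agent's indirect utility from the budget set. -/
noncomputable def agentUtility (M : Mechanism β) (w : ℝ) : ℝ := payoff w (M.outcome (w, 0))

theorem IC.payoff_le_agentUtility (hIC : M.IC b) (hIR : M.IR) (hb : 0 ≤ b) {w : ℝ}
    (hw : w ∈ Set.Icc 0 β) {z : Outcome} (hz : z ∈ budgetSet b M.range) :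
    payoff w z ≤ M.agentUtility w :=
  (hIC.outcome_mk_zero_mem hIR hb hw).2 z hz

theorem IC.agentUtility_nonneg (hIC : M.IC b) (hIR : M.IR) (hb : 0 ≤ b) {w : ℝ}
    (hw : w ∈ Set.Icc 0 β) : 0 ≤ M.agentUtility w := by
  simpa [payoff] using hIC.payoff_le_agentUtility hIR hb hw (zero_mem_budgetSet hb hIR)

theorem IC.agentUtility_mono (hIC : M.IC b) (hIR : M.IR) (hb : 0 ≤ b) {w w' : ℝ}
    (hw : w ∈ Set.Icc 0 β) (hw' : w' ∈ Set.Icc 0 β) (h : w ≤ w') :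
    M.agentUtility w ≤ M.agentUtility w' := by
  have h1 := hIC.payoff_le_agentUtility hIR hb hw' (hIC.outcome_mk_zero_mem hIR hb hw).1
  have h2 : 0 ≤ M.q (w, 0) := (M.q_mem _ (mk_zero_mem_typeSpace hw)).1
  refine le_trans ?_ h1
  simp only [agentUtility, payoff, outcome]
  nlinarith

/-- The agent's utility of the principal's choice dominates that of the budget set. -/
theorem IC.agentUtility_le_of_lt_payment (hIC : M.IC b) {v : ℝ × ℝ}
    (hv : v ∈ typeSpace β) (hp : b < M.p v) (hIR : M.IR) (hb : 0 ≤ b) :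
    M.agentUtility v.2 ≤ v.2 * M.q v - M.p v :=
  (hIC.outcome_mem_of_lt_payment hv hp).2 _ (hIC.outcome_mk_zero_mem hIR hb hv.2.1).1.1

/-! ### The POST-1 and POST-2 mechanisms and their incentive compatibility -/

open Classical in
/-- The mechanism posting the price `κ` to the agent. -/
noncomputable def post1 (β κ : ℝ) : Mechanism β where
  q v := if v.1 ≤ κ then 0 else 1
  p v := if v.1 ≤ κ then 0 else κ
  q_mem v _ := by split_ifs <;> simp

theorem outcome_post1 (κ : ℝ) (v : ℝ × ℝ) :
    (post1 β κ).outcome v = if v.1 ≤ κ then (0, 0) else (1, κ) := by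
  simp only [outcome, post1]; split_ifs <;> rfl

theorem isPost1_post1 {κ : ℝ} (hκ : κ ∈ Set.Icc 0 b) : (post1 β κ).IsPost1 b :=
  ⟨κ, hκ, fun v _ => outcome_post1 κ v⟩

theorem ir_post1 (hβ : 0 ≤ β) {κ : ℝ} (hκ : 0 ≤ κ) : (post1 β κ).IR :=
  ⟨(0, 0), mk_zero_mem_typeSpace ⟨le_rfl, hβ⟩, by simp [outcome_post1, hκ]⟩

theorem range_post1_subset {κ : ℝ} {z : Outcome} (hz : z ∈ (post1 β κ).range) :
    z = (0, 0) ∨ z = (1, κ) := by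
  obtain ⟨v, -, rfl⟩ := hz
  rw [outcome_post1]; split_ifs <;> simp

/-- A mechanism all of whose payments are within budget is incentive compatible if every agent
gets a payoff-maximal outcome. -/
theorem ic_of_payment_le (hp : ∀ v ∈ typeSpace β, M.p v ≤ b)
    (h : ∀ v ∈ typeSpace β, M.outcome v ∈ choice M.range v.1) : M.IC b := by
  have hX : budgetSet b M.range = M.range := by
    ext z
    refine ⟨fun hz => hz.1, fun hz => ⟨hz, ?_⟩⟩
    obtain ⟨v, hv, rfl⟩ := hz
    exact hp v hv
  intro v hv
  unfold pairChoice
  rw [hX, if_neg]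
  · exact h v hv
  · rintro ⟨-, x, hx, y, hy, hlt⟩
    exact absurd hlt (not_lt.mpr (hy.2 x hx.1))

theorem ic_post1 {κ : ℝ} (hκ : κ ∈ Set.Icc 0 b) : (post1 β κ).IC b := by
  refine ic_of_payment_le (fun v _ => ?_) (fun v hv => ⟨outcome_mem_range hv, fun z hz => ?_⟩)
  · simp only [post1]; split_ifs
    · exact hκ.1.trans hκ.2
    · exact hκ.2
  · rw [outcome_post1]
    rcases range_post1_subset hz with rfl | rfl <;> split_ifs with h <;> simp only [payoff] <;>
      linarith

open Classical in
/-- The mechanism with cutoffs `κ₁` for the agent and `κ₂` for the principal, which sells the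
share `b / κ₁` at the price `b`, and the remaining share at the unit price `κ₂`. -/
noncomputable def post2 (β : ℝ) {b κ₁ : ℝ} (κ₂ : ℝ) (hb : 0 ≤ b) (h0 : 0 < κ₁) (h1 : b ≤ κ₁) :
    Mechanism β where
  q v := if v.1 < κ₁ then 0 else if κ₂ < v.2 then 1 else b / κ₁
  p v := if v.1 < κ₁ then 0 else if κ₂ < v.2 then b + κ₂ * (1 - b / κ₁) else b
  q_mem v _ := by
    split_ifs
    · simp
    · simp
    · exact ⟨by positivity, (div_le_one h0).2 h1⟩

section post2

variable {κ₁ κ₂ : ℝ} (hb : 0 ≤ b) (h0 : 0 < κ₁) (h1 : b ≤ κ₁)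

theorem outcome_post2 (v : ℝ × ℝ) :
    (post2 β κ₂ hb h0 h1).outcome v = if v.1 < κ₁ then (0, 0)
      else if κ₂ < v.2 then (1, b + κ₂ * (1 - b / κ₁)) else (b / κ₁, b) := by
  simp only [outcome, post2]; split_ifs <;> rfl

theorem isPost2_post2 (h12 : κ₁ ≤ κ₂) (h2 : κ₂ ≤ β) : (post2 β κ₂ hb h0 h1).IsPost2 b :=
  ⟨κ₁, ⟨h1, h12.trans h2⟩, κ₂, ⟨h1.trans h12, h2⟩, h0, h12, fun v _ => outcome_post2 hb h0 h1 v⟩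

theorem ir_post2 (hβ : 0 ≤ β) : (post2 β κ₂ hb h0 h1).IR :=
  ⟨(0, 0), mk_zero_mem_typeSpace ⟨le_rfl, hβ⟩, by simp [outcome_post2, h0]⟩

theorem range_post2_subset {z : Outcome} (hz : z ∈ (post2 β κ₂ hb h0 h1).range) :
    z = (0, 0) ∨ z = (1, b + κ₂ * (1 - b / κ₁)) ∨ z = (b / κ₁, b) := by
  obtain ⟨v, -, rfl⟩ := hz
  rw [outcome_post2]; split_ifs <;> simp

/-- Valuation `κ₁` is indifferent between nothing and the share `b / κ₁`, and `κ₂` between that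
share and the whole good. As `κ₁ ≤ κ₂`, a principal makes a difference only by buying the whole
good. The degenerate case is `b = κ₁`, where the share is already the whole good. -/
theorem ic_post2 (hβ : 0 ≤ β) (h12 : κ₁ ≤ κ₂) : (post2 β κ₂ hb h0 h1).IC b := by
  set M := post2 β κ₂ hb h0 h1 with hM
  have hIR : M.IR := ir_post2 hb h0 h1 hβ
  obtain ⟨s, hs⟩ : ∃ s, s = b / κ₁ := ⟨_, rfl⟩
  have hsκ : s * κ₁ = b := by rw [hs]; field_simp
  have hs0 : 0 ≤ s := by rw [hs]; positivity
  have hs1 : s ≤ 1 := by rw [hs]; exact (div_le_one h0).2 h1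
  have hout := outcome_post2 (β := β) (κ₂ := κ₂) hb h0 h1
  have hsub := fun z => range_post2_subset (β := β) (κ₂ := κ₂) hb h0 h1 (z := z)
  rw [← hM] at hout hsub
  rw [← hs] at hout hsub
  -- within the budget, the agent's cutoff is `κ₁`
  have hbud : ∀ z ∈ budgetSet b M.range, z = (0, 0) ∨ z = (s, b) := by
    intro z hz
    rcases hsub z hz.1 with h | h | h
    · exact Or.inl h
    · right
      have h2 := hz.2
      rw [h] at h2 ⊢
      simp only at h2
      have h3 : κ₂ * (1 - s) = 0 :=
        le_antisymm (by linarith) (mul_nonneg (h0.le.trans h12) (by linarith))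
      have h4 : (1 : ℝ) - s = 0 := by
        rcases mul_eq_zero.1 h3 with h | h
        · linarith
        · exact h
      ext <;> simp only <;> linarith
    · exact Or.inr h
  intro v hv
  have hz0 : ((0, 0) : Outcome) ∈ budgetSet b M.range := zero_mem_budgetSet hb hIR
  have hvv : v.2 ≤ v.1 := hv.2.2
  have hmem := outcome_mem_range (M := M) hv
  have hov := hout v
  unfold pairChoice
  by_cases hv1 : v.1 < κ₁
  · rw [if_pos hv1] at hov
    rw [hov] at hmem ⊢
    -- Both purchases cost at least `κ₁` per unit, since `b = s * κ₁` and the remaining share costs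
    -- `κ₂ ≥ κ₁` per unit.
    have hbest : ∀ w ≤ v.1, ∀ z ∈ M.range, payoff w z ≤ 0 := by
      intro w hw z hz
      rcases hsub z hz with rfl | rfl | rfl <;> simp only [payoff]
      · linarith
      · nlinarith [mul_nonneg (sub_nonneg.2 h12) (sub_nonneg.2 hs1)]
      · nlinarith
    have hc : ∀ w ≤ v.1, ((0, 0) : Outcome) ∈ choice M.range w := fun w hw =>
      ⟨hmem, fun z hz => (hbest w hw z hz).trans (by simp [payoff])⟩
    split_ifs
    · exact hc _ hvv
    · exact ⟨hz0, fun z hz => (hc _ le_rfl).2 z hz.1⟩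
  · rw [if_neg hv1] at hov
    push Not at hv1
    by_cases hv2 : κ₂ < v.2
    · rw [if_pos hv2] at hov
      rw [hov] at hmem ⊢
      have hc : ((1, b + κ₂ * (1 - s)) : Outcome) ∈ choice M.range v.2 := by
        refine ⟨hmem, fun z hz => ?_⟩
        rcases hsub z hz with rfl | rfl | rfl <;> simp only [payoff]
        · nlinarith [mul_nonneg (sub_nonneg.2 h12) (sub_nonneg.2 hs1),
            mul_nonneg (sub_nonneg.2 h12) hs0]
        · rfl
        · nlinarith [mul_nonneg (sub_nonneg.2 hv2.le) (sub_nonneg.2 hs1)]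
      split_ifs with hS
      · exact hc
      · -- this happens only if the full allocation is within the budget
        by_cases hs1' : s = 1
        · subst hs1'
          refine ⟨⟨hmem, by simp⟩, fun z hz => ?_⟩
          rcases hbud z hz with rfl | rfl <;> simp only [payoff] <;> linarith
        · exfalso
          apply hS
          have hs1'' : s < 1 := lt_of_le_of_ne hs1 hs1'
          have hstr : ∀ y ∈ budgetSet b M.range, ∀ x ∈ choice M.range v.2,
              payoff v.1 y < payoff v.1 x := by
            intro y hy x hx
            have hgap : 0 < (v.2 - κ₂) * (1 - s) := mul_pos (by linarith) (by linarith)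
            have hgap1 : (v.2 - κ₂) * (1 - s) ≤ (v.1 - κ₂) * (1 - s) :=
              mul_le_mul_of_nonneg_right (by linarith) (by linarith)
            have hgap2 : 0 ≤ (κ₂ - κ₁) * s := mul_nonneg (by linarith) hs0
            have hgap3 : 0 ≤ (v.2 - κ₂) * s := mul_nonneg (by linarith) hs0
            have hgap4 : 0 ≤ (v.1 - v.2) * s := mul_nonneg (by linarith) hs0
            have hxb := hx.2 _ hc.1
            have hx' : x = (1, b + κ₂ * (1 - s)) := by
              rcases hsub x hx.1 with rfl | rfl | rfl
              · simp only [payoff] at hxb; exfalso; nlinarith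
              · rfl
              · simp only [payoff] at hxb; exfalso; nlinarith
            rw [hx']
            rcases hbud y hy with rfl | rfl <;> simp only [payoff] <;> nlinarith
          obtain ⟨y, hy⟩ : (choice (budgetSet b M.range) v.1).Nonempty := by
            by_cases hin : ((s, b) : Outcome) ∈ budgetSet b M.range
            · refine ⟨_, hin, fun z hz => ?_⟩
              rcases hbud z hz with rfl | rfl <;> simp only [payoff] <;> nlinarith
            · refine ⟨_, hz0, fun z hz => ?_⟩
              rcases hbud z hz with rfl | rfl
              · rfl
              · exact absurd hz hin
          exact ⟨fun x hx y hy => (hstr y hy.1 x hx).le, _, hc, y, hy, hstr y hy.1 _ hc⟩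
    · rw [if_neg hv2] at hov
      push Not at hv2
      rw [hov] at hmem ⊢
      have hcb : ((s, b) : Outcome) ∈ choice (budgetSet b M.range) v.1 := by
        refine ⟨⟨hmem, le_rfl⟩, fun z hz => ?_⟩
        rcases hbud z hz with rfl | rfl <;> simp only [payoff] <;> nlinarith
      split_ifs with hS
      · by_cases hκ : κ₁ ≤ v.2
        · refine ⟨hmem, fun z hz => ?_⟩
          rcases hsub z hz with rfl | rfl | rfl <;> simp only [payoff]
          · nlinarith
          · nlinarith [mul_nonneg (sub_nonneg.2 hv2) (sub_nonneg.2 hs1)]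
          · rfl
        · -- below `κ₁` the principal does not buy, so the agent cannot gain
          exfalso
          push Not at hκ
          obtain ⟨-, x, hx, y, hy, hlt⟩ := hS
          have hx0 := hx.2 _ hIR
          have hle : payoff v.1 x ≤ payoff v.1 (s, b) := by
            rcases hsub x hx.1 with rfl | rfl | rfl
            · exact hcb.2 _ hz0
            · simp only [payoff] at hx0
              exfalso
              nlinarith [mul_nonneg (sub_nonneg.2 h12) (sub_nonneg.2 hs1)]
            · rfl
          exact absurd (hlt.trans_le hle) (not_lt.2 (hy.2 _ hcb.1))
      · exact hcb

end post2

end Mechanism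

end PrincipalAgent

/-! ### Tail probabilities and the revenue of threshold payments -/

namespace PrincipalAgent

theorem measurableSet_typeSpace (β : ℝ) : MeasurableSet (typeSpace β) := by
  have h : IsClosed (typeSpace β) :=
    (isClosed_Icc.preimage continuous_fst).inter
      ((isClosed_Icc.preimage continuous_snd).inter (isClosed_le continuous_snd continuous_fst))
  exact h.measurableSet

/-- The probability that the statistic `w` of the type exceeds `x`. -/
noncomputable def tail (β : ℝ) (f w : ℝ × ℝ → ℝ) (x : ℝ) : ℝ :=
  ∫ v in typeSpace β, {v | x < w v}.indicator f v

theorem quasiMeasurePreserving_fst :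
    Measure.QuasiMeasurePreserving (Prod.fst : ℝ × ℝ → ℝ) volume volume :=
  Measure.quasiMeasurePreserving_fst

theorem quasiMeasurePreserving_snd :
    Measure.QuasiMeasurePreserving (Prod.snd : ℝ × ℝ → ℝ) volume volume :=
  Measure.quasiMeasurePreserving_snd

section tail

variable {β : ℝ} {f w : ℝ × ℝ → ℝ}

theorem ae_ne_of_quasiMeasurePreserving (hw : Measure.QuasiMeasurePreserving w volume volume)
    (x : ℝ) : ∀ᵐ v ∂(volume.restrict (typeSpace β)), w v ≠ x := by
  refine ae_restrict_of_ae ?_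
  have : volume (w ⁻¹' {x}) = 0 := hw.preimage_null (by simp)
  exact measure_eq_zero_iff_ae_notMem.1 this

theorem IsJointDensity.integrable_indicator (hf : IsJointDensity β f)
    {s : Set (ℝ × ℝ)} (hs : MeasurableSet s) :
    Integrable (s.indicator f) (volume.restrict (typeSpace β)) :=
  hf.integrable.indicator hs

theorem IsJointDensity.ae_nonneg (hf : IsJointDensity β f) :
    ∀ᵐ v ∂(volume.restrict (typeSpace β)), 0 ≤ f v :=
  ae_restrict_of_forall_mem (measurableSet_typeSpace β) hf.nonneg

theorem tail_eq_integral_le (hw : Measure.QuasiMeasurePreserving w volume volume) (x : ℝ) :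
    tail β f w x = ∫ v in typeSpace β, {v | x ≤ w v}.indicator f v := by
  refine integral_congr_ae ?_
  filter_upwards [ae_ne_of_quasiMeasurePreserving (β := β) hw x] with v hv
  simp only [Set.indicator, Set.mem_ofPred_eq, lt_iff_le_and_ne, ne_eq, Ne.symm hv,
    not_false_eq_true, and_true]

theorem tail_nonneg (hf : IsJointDensity β f) (x : ℝ) : 0 ≤ tail β f w x := by
  refine integral_nonneg_of_ae ?_
  filter_upwards [hf.ae_nonneg] with v hv
  exact Set.indicator_apply_nonneg fun _ => hv

theorem tail_le_one (hf : IsJointDensity β f)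
    (hw : Measure.QuasiMeasurePreserving w volume volume) (x : ℝ) : tail β f w x ≤ 1 := by
  rw [← hf.integral_eq_one]
  refine integral_mono_ae
    (hf.integrable_indicator (measurableSet_lt measurable_const hw.measurable)) hf.integrable ?_
  filter_upwards [hf.ae_nonneg] with v hv
  exact Set.indicator_le_self' (fun _ _ => hv) v

theorem tail_antitone (hf : IsJointDensity β f)
    (hw : Measure.QuasiMeasurePreserving w volume volume) : Antitone (tail β f w) := by
  intro x y hxy
  refine integral_mono_ae
    (hf.integrable_indicator (measurableSet_lt measurable_const hw.measurable))
    (hf.integrable_indicator (measurableSet_lt measurable_const hw.measurable)) ?_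
  filter_upwards [hf.ae_nonneg] with v hv
  by_cases h : y < w v
  · rw [Set.indicator_of_mem (show v ∈ {v | y < w v} from h),
      Set.indicator_of_mem (show v ∈ {v | x < w v} from hxy.trans_lt h)]
  · rw [Set.indicator_of_notMem (show v ∉ {v | y < w v} from h)]
    exact Set.indicator_apply_nonneg fun _ => hv

/-- Dominated convergence: off the null set where `w v = x₀`, the indicator is locally constant in
the threshold near `x₀`. -/
theorem continuous_tail (hf : IsJointDensity β f)
    (hw : Measure.QuasiMeasurePreserving w volume volume) : Continuous (tail β f w) := by
  rw [continuous_iff_continuousAt]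
  intro x₀
  refine continuousAt_of_dominated (bound := fun v => ‖f v‖) ?_ ?_ hf.integrable.norm ?_
  · exact Filter.Eventually.of_forall fun x =>
      (hf.integrable_indicator (measurableSet_lt measurable_const hw.measurable)).1
  · exact Filter.Eventually.of_forall fun x => Filter.Eventually.of_forall fun v =>
      norm_indicator_le_norm_self f v
  · filter_upwards [ae_ne_of_quasiMeasurePreserving (β := β) hw x₀] with v hv
    rcases lt_or_gt_of_ne hv with h | h
    · refine (continuousAt_const (y := (0 : ℝ))).congr ?_
      filter_upwards [lt_mem_nhds h] with x hx
      rw [Set.indicator_of_notMem]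
      simpa using hx.le
    · refine (continuousAt_const (y := f v)).congr ?_
      filter_upwards [gt_mem_nhds h] with x hx
      rw [Set.indicator_of_mem]
      exact hx

theorem one_sub_marginalCDF₁ (hf : IsJointDensity β f) (x : ℝ) :
    1 - marginalCDF₁ β f x = tail β f Prod.fst x := by
  have hs : MeasurableSet {v : ℝ × ℝ | v.1 ≤ x} := measurableSet_le measurable_fst measurable_const
  have h := integral_add_compl hs hf.integrable
  rw [hf.integral_eq_one, ← integral_indicator hs, ← integral_indicator hs.compl] at h
  have hc : {v : ℝ × ℝ | v.1 ≤ x}ᶜ = {v | x < v.1} := by ext v; simp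
  rw [hc] at h
  rw [marginalCDF₁, ← setIntegral_indicator hs, tail]
  linarith

end tail

/-- Revenue from a payment rule that is a combination of threshold payments in both coordinates. -/
theorem integral_step_mul {β : ℝ} {f : ℝ × ℝ → ℝ} (hf : IsJointDensity β f) (C : ℝ)
    {ι κ : Type*} (s : Finset ι) (t : Finset κ) (c x : ι → ℝ) (d y : κ → ℝ) :
    Integrable (fun v => C * f v + (∑ i ∈ s, c i * {v | x i ≤ v.1}.indicator f v)
      + ∑ j ∈ t, d j * {v | y j ≤ v.2}.indicator f v) (volume.restrict (typeSpace β)) ∧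
    ∫ v in typeSpace β, (C * f v + (∑ i ∈ s, c i * {v | x i ≤ v.1}.indicator f v)
      + ∑ j ∈ t, d j * {v | y j ≤ v.2}.indicator f v) =
      C + (∑ i ∈ s, c i * tail β f Prod.fst (x i)) + ∑ j ∈ t, d j * tail β f Prod.snd (y j) := by
  have h1 : ∀ i ∈ s, Integrable (fun v => c i * {v | x i ≤ v.1}.indicator f v)
      (volume.restrict (typeSpace β)) := fun i _ =>
    (hf.integrable_indicator (measurableSet_le measurable_const measurable_fst)).const_mul _
  have h2 : ∀ j ∈ t, Integrable (fun v => d j * {v | y j ≤ v.2}.indicator f v)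
      (volume.restrict (typeSpace β)) := fun j _ =>
    (hf.integrable_indicator (measurableSet_le measurable_const measurable_snd)).const_mul _
  have h0 : Integrable (fun v => C * f v) (volume.restrict (typeSpace β)) :=
    Integrable.const_mul hf.integrable C
  have i1 := integrable_finsetSum s h1
  have i2 := integrable_finsetSum t h2
  have i01 : Integrable (fun v => C * f v + ∑ i ∈ s, c i * {v | x i ≤ v.1}.indicator f v)
      (volume.restrict (typeSpace β)) := h0.add i1
  refine ⟨i01.add i2, ?_⟩
  rw [integral_add i01 i2, integral_add h0 i1, integral_finsetSum s h1,
    integral_finsetSum t h2, integral_const_mul, hf.integral_eq_one, mul_one]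
  simp only [integral_const_mul, ← tail_eq_integral_le quasiMeasurePreserving_fst,
    ← tail_eq_integral_le quasiMeasurePreserving_snd]

namespace Mechanism

variable {β b : ℝ} {f : ℝ × ℝ → ℝ}

/-- A payment rule dominated almost everywhere by a combination of threshold payments earns at
most the corresponding combination of tails. -/
theorem revenue_le_of_payment_le_step (hf : IsJointDensity β f) {M : Mechanism β}
    (hM : IntegrableOn (fun v => M.p v * f v) (typeSpace β)) (C : ℝ)
    {ι κ : Type*} (s : Finset ι) (t : Finset κ) (c x : ι → ℝ) (d y : κ → ℝ)
    (h : ∀ v ∈ typeSpace β, v.2 < β → M.p v ≤ C + (∑ i ∈ s, if x i ≤ v.1 then c i else 0)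
      + ∑ j ∈ t, if y j ≤ v.2 then d j else 0) :
    M.revenue f ≤
      C + (∑ i ∈ s, c i * tail β f Prod.fst (x i)) + ∑ j ∈ t, d j * tail β f Prod.snd (y j) := by
  obtain ⟨h1, h2⟩ := integral_step_mul hf C s t c x d y
  rw [← h2]
  refine integral_mono_ae hM h1 ?_
  filter_upwards [ae_restrict_mem (measurableSet_typeSpace β),
    ae_ne_of_quasiMeasurePreserving (β := β) quasiMeasurePreserving_snd β] with v hv hvβ
  refine (mul_le_mul_of_nonneg_right (h v hv (lt_of_le_of_ne hv.2.1.2 hvβ))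
    (hf.nonneg v hv)).trans_eq ?_
  simp only [add_mul, Finset.sum_mul, Set.indicator, Set.mem_ofPred_eq, ite_mul, mul_ite, zero_mul,
    mul_zero]

theorem post1_revenue (hf : IsJointDensity β f) (κ : ℝ) :
    IntegrableOn (fun v => (post1 β κ).p v * f v) (typeSpace β) ∧
      (post1 β κ).revenue f = κ * tail β f Prod.fst κ := by
  have h : (fun v => (post1 β κ).p v * f v) = fun v => κ * {v | κ < v.1}.indicator f v := by
    funext v
    simp only [post1, Set.indicator, Set.mem_ofPred_eq]
    split_ifs <;> linarith
  rw [revenue, h]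
  exact ⟨(hf.integrable_indicator (measurableSet_lt measurable_const measurable_fst)).const_mul _,
    integral_const_mul _ _⟩

theorem post2_revenue (hf : IsJointDensity β f) {κ₁ κ₂ : ℝ} (hb : 0 ≤ b) (h0 : 0 < κ₁)
    (h1 : b ≤ κ₁) (h12 : κ₁ ≤ κ₂) :
    IntegrableOn (fun v => (post2 β κ₂ hb h0 h1).p v * f v) (typeSpace β) ∧
      (post2 β κ₂ hb h0 h1).revenue f =
        b * tail β f Prod.fst κ₁ + κ₂ * (1 - b / κ₁) * tail β f Prod.snd κ₂ := by
  have h : Set.EqOn (fun v => b * {v | κ₁ ≤ v.1}.indicator f v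
      + κ₂ * (1 - b / κ₁) * {v | κ₂ < v.2}.indicator f v)
      (fun v => (post2 β κ₂ hb h0 h1).p v * f v) (typeSpace β) := by
    intro v hv
    have hvv : v.2 ≤ v.1 := hv.2.2
    simp only [post2, Set.indicator, Set.mem_ofPred_eq]
    split_ifs <;> first | (exfalso; linarith) | ring
  have i1 : Integrable (fun v => b * {v | κ₁ ≤ v.1}.indicator f v)
      (volume.restrict (typeSpace β)) :=
    (hf.integrable_indicator (measurableSet_le measurable_const measurable_fst)).const_mul _
  have i2 : Integrable (fun v => κ₂ * (1 - b / κ₁) * {v | κ₂ < v.2}.indicator f v)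
      (volume.restrict (typeSpace β)) :=
    (hf.integrable_indicator (measurableSet_lt measurable_const measurable_snd)).const_mul _
  refine ⟨IntegrableOn.congr_fun (i1.add i2) h (measurableSet_typeSpace β), ?_⟩
  rw [revenue, ← setIntegral_congr_fun (measurableSet_typeSpace β) h, integral_add i1 i2,
    integral_const_mul, integral_const_mul, ← tail_eq_integral_le quasiMeasurePreserving_fst]
  rfl

end Mechanism

end PrincipalAgent

/-! ### Grid approximation of payment schedules and Jensen's inequality -/

namespace PrincipalAgent

open Filter Topology

/-- The `i`-th point of the uniform grid with `n` cells on `[l, r]`. -/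
noncomputable def grid (l r : ℝ) (n i : ℕ) : ℝ := l + i * ((r - l) / n)

theorem grid_zero (l r : ℝ) (n : ℕ) : grid l r n 0 = l := by simp [grid]

theorem grid_self (l r : ℝ) {n : ℕ} (hn : 0 < n) : grid l r n n = r := by
  have : (n : ℝ) ≠ 0 := by positivity
  simp only [grid]; field_simp; ring

theorem grid_succ (l r : ℝ) (n i : ℕ) : grid l r n (i + 1) = grid l r n i + (r - l) / n := by
  simp only [grid]; push_cast; ring

theorem grid_mono {l r : ℝ} (h : l ≤ r) (n : ℕ) : Monotone (grid l r n) := by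
  refine monotone_nat_of_le_succ fun i => ?_
  rw [grid_succ]
  have : 0 ≤ (r - l) / n := div_nonneg (by linarith) (by positivity)
  linarith

theorem grid_mem {l r : ℝ} (h : l ≤ r) {n i : ℕ} (hn : 0 < n) (hi : i ≤ n) :
    grid l r n i ∈ Set.Icc l r := by
  constructor
  · simpa [grid_zero] using grid_mono h n (Nat.zero_le i)
  · simpa [grid_self l r hn] using grid_mono h n hi

/-- Evaluating a step function built from increments along a monotone grid: at a point below the
`(k+1)`-st grid point, the value dominates the payment `c` if all later values do. -/
theorem le_add_sum_step {x Q : ℕ → ℝ} {n : ℕ} (hx : Monotone x) {c y : ℝ}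
    (hy : x 0 ≤ y) (h : ∀ k, k < n → x k ≤ y → y < x (k + 1) → c ≤ Q (k + 1))
    (hn : x n ≤ y → c ≤ Q n) :
    c ≤ Q 0 + ∑ i ∈ Finset.range n, if x i ≤ y then Q (i + 1) - Q i else 0 := by
  induction n with
  | zero => simpa using hn hy
  | succ n ih =>
    rw [Finset.sum_range_succ]
    by_cases hyn : x n ≤ y
    · have hs : ∀ i ∈ Finset.range n,
          (if x i ≤ y then Q (i + 1) - Q i else 0) = Q (i + 1) - Q i := fun i hi =>
        if_pos ((hx (Finset.mem_range.1 hi).le).trans hyn)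
      rw [Finset.sum_congr rfl hs, Finset.sum_range_sub, if_pos hyn]
      have : c ≤ Q (n + 1) := by
        by_cases h' : x (n + 1) ≤ y
        · exact hn h'
        · exact h n (Nat.lt_succ_self n) hyn (not_le.1 h')
      linarith
    · rw [if_neg hyn, add_zero]
      exact ih (fun k hk => h k (hk.trans (Nat.lt_succ_self n))) (fun h' => absurd h' hyn)

section bounds

variable {G q Q : ℝ → ℝ} {l r : ℝ}

/-- Payments that are implementable by the allocation `q` are, up to the mesh of the grid,
a mixture of posted prices. -/
theorem sum_grid_payment_le (hlr : l < r) (hG : ∀ x, G x ≤ 1) (hG0 : ∀ x, 0 ≤ G x)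
    (hq : ∀ x y, l ≤ x → x < y → y ≤ r → q x ≤ q y)
    (hQ : ∀ x y, l ≤ x → x < y → y ≤ r → Q y - Q x ≤ y * (q y - q x)) {n : ℕ} (hn : 0 < n) :
    ∑ i ∈ Finset.range n, (Q (grid l r n (i + 1)) - Q (grid l r n i)) * G (grid l r n i) ≤
      (∑ i ∈ Finset.range n, (q (grid l r n (i + 1)) - q (grid l r n i)) *
        (grid l r n i * G (grid l r n i))) + (r - l) / n * (q r - q l) := by
  have htel : q r - q l =
      ∑ i ∈ Finset.range n, (q (grid l r n (i + 1)) - q (grid l r n i)) := by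
    rw [Finset.sum_range_sub (fun i => q (grid l r n i)), grid_self l r hn, grid_zero]
  rw [htel, Finset.mul_sum, ← Finset.sum_add_distrib]
  refine Finset.sum_le_sum fun i hi => ?_
  have hi := Finset.mem_range.1 hi
  have hδ : 0 < (r - l) / n := div_pos (by linarith) (by positivity)
  have hs := grid_succ l r n i
  have hlt : grid l r n i < grid l r n (i + 1) := by rw [hs]; linarith
  have hm := grid_mem hlr.le hn hi.le
  have hm' := grid_mem hlr.le hn (Nat.succ_le_of_lt hi)
  have h1 := hq _ _ hm.1 hlt hm'.2
  have h2 := hQ _ _ hm.1 hlt hm'.2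
  have hg := hG (grid l r n i)
  have hg0 := hG0 (grid l r n i)
  -- Moving the price from the right to the left end of a cell costs at most the mesh times the
  -- allocation increment, because `G ≤ 1`.
  calc _ ≤ grid l r n (i + 1) * (q (grid l r n (i + 1)) - q (grid l r n i)) * G (grid l r n i) :=
        mul_le_mul_of_nonneg_right h2 hg0
    _ = (q (grid l r n (i + 1)) - q (grid l r n i)) * (grid l r n i * G (grid l r n i)) +
        ((r - l) / n * (q (grid l r n (i + 1)) - q (grid l r n i))) * G (grid l r n i) := by
        rw [hs]; ring
    _ ≤ _ := by
        have := mul_le_of_le_one_right (mul_nonneg hδ.le (sub_nonneg.2 h1)) hg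
        linarith

theorem tendsto_mesh (l r C : ℝ) :
    Tendsto (fun n : ℕ => (r - l) / n * C) atTop (𝓝 0) := by
  simpa using (tendsto_const_div_atTop_nhds_zero_nat (r - l)).mul_const C

/-- Bound by the best posted price. -/
theorem eventually_sum_grid_le_mul (hlr : l ≤ r) (hG : ∀ x, G x ≤ 1) (hG0 : ∀ x, 0 ≤ G x)
    (hq : ∀ x y, l ≤ x → x < y → y ≤ r → q x ≤ q y)
    (hQ : ∀ x y, l ≤ x → x < y → y ≤ r → Q y - Q x ≤ y * (q y - q x)) {m : ℝ}
    (hm : ∀ x ∈ Set.Icc l r, x * G x ≤ m) {ε : ℝ} (hε : 0 < ε) :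
    ∀ᶠ n : ℕ in atTop,
      ∑ i ∈ Finset.range n, (Q (grid l r n (i + 1)) - Q (grid l r n i)) * G (grid l r n i) ≤
        (q r - q l) * m + ε := by
  rcases hlr.eq_or_lt with rfl | hlr
  · refine Eventually.of_forall fun n => ?_
    simp [grid, hε.le]
  filter_upwards [eventually_gt_atTop 0,
    (tendsto_mesh l r (q r - q l)).eventually_lt_const hε] with n hn hn'
  refine (sum_grid_payment_le hlr hG hG0 hq hQ hn).trans (add_le_add ?_ hn'.le)
  have htel : q r - q l =
      ∑ i ∈ Finset.range n, (q (grid l r n (i + 1)) - q (grid l r n i)) := by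
    rw [Finset.sum_range_sub (fun i => q (grid l r n i)), grid_self l r hn, grid_zero]
  rw [htel, Finset.sum_mul]
  refine Finset.sum_le_sum fun i hi => ?_
  have hi := Finset.mem_range.1 hi
  have hδ : 0 < (r - l) / n := div_pos (by linarith) (by positivity)
  have hlt : grid l r n i < grid l r n (i + 1) := by rw [grid_succ]; linarith
  have hgm := grid_mem hlr.le hn hi.le
  have hgm' := grid_mem hlr.le hn (Nat.succ_le_of_lt hi)
  exact mul_le_mul_of_nonneg_left (hm _ hgm) (sub_nonneg.2 (hq _ _ hgm.1 hlt hgm'.2))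

/-- Jensen's inequality for incentive-compatible payments: with a concave revenue curve, a single
posted price is best. -/
theorem eventually_sum_grid_le_jensen (hr : 0 < r) (hG : ∀ x, G x ≤ 1) (hG0 : ∀ x, 0 ≤ G x)
    (hGc : Continuous G) (hconc : ConcaveOn ℝ (Set.Icc 0 r) (fun x => x * G x))
    (hq : ∀ x y, 0 ≤ x → x < y → y ≤ r → q x ≤ q y)
    (hQ : ∀ x y, 0 ≤ x → x < y → y ≤ r → Q y - Q x ≤ y * (q y - q x))
    (hQ' : ∀ x y, 0 ≤ x → x < y → y ≤ r → x * (q y - q x) ≤ Q y - Q x)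
    (hq0 : 0 ≤ q 0) (hqr : 0 < q r) {ε : ℝ} (hε : 0 < ε) :
    ∀ᶠ n : ℕ in atTop,
      ∑ i ∈ Finset.range n, (Q (grid 0 r n (i + 1)) - Q (grid 0 r n i)) * G (grid 0 r n i) ≤
        (Q r - Q 0) * G ((Q r - Q 0) / q r) + ε := by
  have hδ0 := tendsto_mesh 0 r (q r - q 0)
  -- `D n` is the lower Riemann–Stieltjes sum of price against allocation; it approximates the total
  -- payment `Q r - Q 0`.
  let D : ℕ → ℝ := fun n => ∑ i ∈ Finset.range n,
    (q (grid 0 r n (i + 1)) - q (grid 0 r n i)) * grid 0 r n i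
  have hstep : ∀ n : ℕ, 0 < n → ∀ i ∈ Finset.range n, grid 0 r n i ∈ Set.Icc 0 r ∧
      0 ≤ q (grid 0 r n (i + 1)) - q (grid 0 r n i) ∧
      Q (grid 0 r n (i + 1)) - Q (grid 0 r n i) ≤
        grid 0 r n (i + 1) * (q (grid 0 r n (i + 1)) - q (grid 0 r n i)) ∧
      grid 0 r n i * (q (grid 0 r n (i + 1)) - q (grid 0 r n i)) ≤
        Q (grid 0 r n (i + 1)) - Q (grid 0 r n i) := by
    intro n hn i hi
    have hi := Finset.mem_range.1 hi
    have hδ : 0 < (r - 0) / n := div_pos (by linarith) (by positivity)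
    have hlt : grid 0 r n i < grid 0 r n (i + 1) := by rw [grid_succ]; linarith
    have hm := grid_mem hr.le hn hi.le
    have hm' := grid_mem hr.le hn (Nat.succ_le_of_lt hi)
    exact ⟨hm, sub_nonneg.2 (hq _ _ hm.1 hlt hm'.2), hQ _ _ hm.1 hlt hm'.2,
      hQ' _ _ hm.1 hlt hm'.2⟩
  have htel : ∀ g : ℝ → ℝ, ∀ n : ℕ, 0 < n →
      ∑ i ∈ Finset.range n, (g (grid 0 r n (i + 1)) - g (grid 0 r n i)) = g r - g 0 := by
    intro g n hn
    rw [Finset.sum_range_sub (fun i => g (grid 0 r n i)), grid_self 0 r hn, grid_zero]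
  have hDu : ∀ n : ℕ, 0 < n → D n ≤ Q r - Q 0 := by
    intro n hn
    rw [← htel Q n hn]
    exact Finset.sum_le_sum fun i hi => by linarith [(hstep n hn i hi).2.2.2]
  have hDl : ∀ n : ℕ, 0 < n → Q r - Q 0 - (r - 0) / n * (q r - q 0) ≤ D n := by
    intro n hn
    rw [← htel Q n hn, ← htel q n hn, Finset.mul_sum, ← Finset.sum_sub_distrib]
    refine Finset.sum_le_sum fun i hi => ?_
    have := (hstep n hn i hi).2.2.1
    rw [grid_succ, add_mul] at this
    rw [grid_succ]
    linarith
  have hDt : Tendsto D atTop (𝓝 (Q r - Q 0)) := by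
    refine tendsto_of_tendsto_of_tendsto_of_le_of_le'
      (g := fun n : ℕ => Q r - Q 0 - (r - 0) / n * (q r - q 0)) (h := fun _ => Q r - Q 0)
      ?_ tendsto_const_nhds ?_ ?_
    · simpa using tendsto_const_nhds.sub hδ0
    · filter_upwards [eventually_gt_atTop 0] with n hn using hDl n hn
    · filter_upwards [eventually_gt_atTop 0] with n hn using hDu n hn
  have hJ : ∀ n : ℕ, 0 < n → ∑ i ∈ Finset.range n,
      (q (grid 0 r n (i + 1)) - q (grid 0 r n i)) * (grid 0 r n i * G (grid 0 r n i)) ≤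
        D n * G (D n / q r) := by
    intro n hn
    -- The increments of `q` have total mass `q r - q 0`; the missing mass `q 0` is put at price
    -- zero, which earns nothing, so that the weights add up to one.
    have h := hconc.le_map_sum (t := Finset.range (n + 1))
      (w := fun i => Nat.casesOn i (q 0 / q r)
        (fun i => (q (grid 0 r n (i + 1)) - q (grid 0 r n i)) / q r))
      (p := fun i => Nat.casesOn i 0 (fun i => grid 0 r n i)) ?_ ?_ ?_
    · rw [Finset.sum_range_succ', Finset.sum_range_succ'] at h
      simp only [smul_eq_mul, Nat.rec_zero, mul_zero, zero_mul, add_zero] at h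
      have e1 : ∑ i ∈ Finset.range n, (q (grid 0 r n (i + 1)) - q (grid 0 r n i)) / q r *
          grid 0 r n i = D n / q r := by
        rw [Finset.sum_div]; exact Finset.sum_congr rfl fun i _ => by ring
      have e2 : ∑ i ∈ Finset.range n, (q (grid 0 r n (i + 1)) - q (grid 0 r n i)) / q r *
          (grid 0 r n i * G (grid 0 r n i)) = (∑ i ∈ Finset.range n,
          (q (grid 0 r n (i + 1)) - q (grid 0 r n i)) * (grid 0 r n i * G (grid 0 r n i)))
            / q r := by
        rw [Finset.sum_div]; exact Finset.sum_congr rfl fun i _ => by ring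
      rw [e1, e2, div_le_iff₀ hqr] at h
      refine h.trans_eq ?_
      field_simp
    · rintro (_ | i) hi
      · exact div_nonneg hq0 hqr.le
      · exact div_nonneg (hstep n hn i (by simpa using hi)).2.1 hqr.le
    · rw [Finset.sum_range_succ']
      simp only [Nat.rec_zero]
      rw [← Finset.sum_div, htel q n hn]
      field_simp
      ring
    · rintro (_ | i) hi
      · exact ⟨le_rfl, hr.le⟩
      · exact (hstep n hn i (by simpa using hi)).1
  have hlim : Tendsto (fun n : ℕ => D n * G (D n / q r) + (r - 0) / n * (q r - q 0)) atTop
      (𝓝 ((Q r - Q 0) * G ((Q r - Q 0) / q r) + 0)) :=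
    (hDt.mul ((hGc.tendsto _).comp (hDt.div_const _))).add hδ0
  filter_upwards [eventually_gt_atTop 0,
    hlim.eventually_lt_const (show _ < (Q r - Q 0) * G ((Q r - Q 0) / q r) + ε by linarith)]
    with n hn hn'
  exact ((sum_grid_payment_le hr hG hG0 hq hQ hn).trans (add_le_add (hJ n hn) le_rfl)).trans hn'.le

end bounds

end PrincipalAgent

/-! ### The agents' payment schedule -/

namespace PrincipalAgent

open Filter Topology

namespace Mechanism

variable {β b : ℝ} {M : Mechanism β} {f : ℝ × ℝ → ℝ}

section agentSchedule

/-- The payment schedule of agents choosing from the budget set, completed at the valuation `r`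
by the payment `t`. -/
noncomputable def agentPayment (M : Mechanism β) (r t x : ℝ) : ℝ :=
  if x < r then M.p (x, 0) else t

/-- The allocation matching `agentPayment`: at `r`, the agent is indifferent between her choice and
the outcome with payment `t`. -/
noncomputable def agentAllocation (M : Mechanism β) (r t x : ℝ) : ℝ :=
  if x < r then M.q (x, 0) else (t + M.agentUtility r) / r

theorem IC.agentSchedule_bounds (hIC : M.IC b) (hIR : M.IR) (hb : 0 ≤ b) {r t x y : ℝ}
    (hr : 0 < r) (hrβ : r ≤ β) (ht : M.p (r, 0) ≤ t) (hx : 0 ≤ x) (hxy : x < y) (hy : y ≤ r) :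
    M.agentAllocation r t x ≤ M.agentAllocation r t y ∧
    M.agentPayment r t y - M.agentPayment r t x ≤
      y * (M.agentAllocation r t y - M.agentAllocation r t x) ∧
    x * (M.agentAllocation r t y - M.agentAllocation r t x) ≤
      M.agentPayment r t y - M.agentPayment r t x := by
  have hxr : x < r := hxy.trans_le hy
  have hcx := hIC.outcome_mk_zero_mem hIR hb (w := x) ⟨hx, by linarith⟩
  have hcy := hIC.outcome_mk_zero_mem hIR hb (w := y) ⟨by linarith, by linarith⟩
  obtain ⟨h1, h2⟩ := choice_payment_bounds hcx hcy
  have h3 := choice_allocation_mono hcx hcy hxy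
  simp only [outcome] at h1 h2 h3
  simp only [agentAllocation, agentPayment, if_pos hxr]
  rcases hy.lt_or_eq with hyr | rfl
  · simp only [if_pos hyr]
    exact ⟨h3, h2, h1⟩
  · simp only [lt_irrefl, if_false]
    have hu : M.agentUtility y = y * M.q (y, 0) - M.p (y, 0) := rfl
    obtain ⟨a, ha⟩ : ∃ a, a = (t + M.agentUtility y) / y := ⟨_, rfl⟩
    rw [← ha]
    have hya : y * a = t + M.agentUtility y := by rw [ha]; field_simp
    have hqa : M.q (y, 0) ≤ a := by
      by_contra hlt
      push Not at hlt
      nlinarith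
    refine ⟨h3.trans hqa, by linarith, ?_⟩
    have := mul_le_mul_of_nonneg_right hxy.le (sub_nonneg.2 hqa)
    linarith

theorem IC.payment_le_agentPayment (hIC : M.IC b) (hIR : M.IR) (hb : 0 ≤ b) {r t y : ℝ}
    (hrβ : r ≤ β) (ht : M.p (r, 0) ≤ t) (hy : y ≤ r) {v : ℝ × ℝ}
    (hv : v ∈ typeSpace β) (hp : M.p v ≤ b) (hvy : v.1 < y) : M.p v ≤ M.agentPayment r t y := by
  have hv0 : 0 ≤ v.1 := hv.1.1
  have h := choice_payment_mono (hIC.outcome_mem_of_payment_le hIR hb hv hp)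
    (hIC.outcome_mk_zero_mem hIR hb (w := y) ⟨by linarith, by linarith⟩) hv0 hvy
  simp only [outcome] at h
  unfold agentPayment
  split_ifs with hyr
  · exact h
  · obtain rfl : y = r := le_antisymm hy (not_lt.1 hyr)
    exact h.trans ht

/-- The revenue of the agents' schedule is at most that of a single posted price. -/
theorem IC.eventually_agentSchedule_le (hIC : M.IC b) (hIR : M.IR) (hb : 0 ≤ b)
    (hf : IsJointDensity β f)
    (hconc : ConcaveOn ℝ (Set.Icc 0 β) (fun x => x * tail β f Prod.fst x)) {r t : ℝ}
    (hr : 0 < r) (hrβ : r ≤ β) (ht : M.p (r, 0) ≤ t) (ht0 : 0 < t) {ε : ℝ} (hε : 0 < ε) :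
    ∀ᶠ n : ℕ in atTop, M.agentPayment r t 0 + ∑ i ∈ Finset.range n,
      (M.agentPayment r t (grid 0 r n (i + 1)) - M.agentPayment r t (grid 0 r n i)) *
        tail β f Prod.fst (grid 0 r n i) ≤
      t * tail β f Prod.fst (t / ((t + M.agentUtility r) / r)) + ε := by
  have h0mem : (0 : ℝ) ∈ Set.Icc 0 β := ⟨le_rfl, hr.le.trans hrβ⟩
  have hur := hIC.agentUtility_nonneg hIR hb (w := r) ⟨hr.le, hrβ⟩
  have hQr : M.agentPayment r t r = t := by simp [agentPayment]
  have hqr : M.agentAllocation r t r = (t + M.agentUtility r) / r := by simp [agentAllocation]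
  have hqr0 : 0 < M.agentAllocation r t r := by rw [hqr]; positivity
  have hQ0 : M.agentPayment r t 0 ≤ 0 := by
    have := hIC.agentUtility_nonneg hIR hb h0mem
    simp only [agentUtility, payoff, outcome] at this
    simp only [agentPayment, if_pos hr]
    linarith
  have hq0 : 0 ≤ M.agentAllocation r t 0 := by
    simp only [agentAllocation, if_pos hr]
    exact (M.q_mem _ (mk_zero_mem_typeSpace h0mem)).1
  have hle1 : ∀ x, tail β f Prod.fst x ≤ 1 := tail_le_one hf quasiMeasurePreserving_fst
  have hB := fun x y hx hxy hy =>
    hIC.agentSchedule_bounds hIR hb (x := x) (y := y) hr hrβ ht hx hxy hy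
  filter_upwards [eventually_sum_grid_le_jensen hr hle1
    (tail_nonneg hf) (continuous_tail hf quasiMeasurePreserving_fst)
    (hconc.subset (Set.Icc_subset_Icc_right hrβ) (convex_Icc 0 r))
    (fun x y hx hxy hy => (hB x y hx hxy hy).1) (fun x y hx hxy hy => (hB x y hx hxy hy).2.1)
    (fun x y hx hxy hy => (hB x y hx hxy hy).2.2) hq0 hqr0 hε] with n hn
  rw [hQr, hqr] at hn
  rw [hqr] at hqr0
  -- Jensen gives the total payment `t - Q 0` with `Q 0 ≤ 0`. Dropping this subsidy does not lower
  -- the bound: it lowers the price, and `-Q 0` is recovered only with probability at most one.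
  have hG := tail_antitone hf quasiMeasurePreserving_fst
    (show t / ((t + M.agentUtility r) / r) ≤
      (t - M.agentPayment r t 0) / ((t + M.agentUtility r) / r) by gcongr; linarith)
  have h1 := hle1 ((t - M.agentPayment r t 0) / ((t + M.agentUtility r) / r))
  have h2 := mul_le_mul_of_nonneg_left hG ht0.le
  have h3 := mul_nonneg (neg_nonneg.2 hQ0) (sub_nonneg.2 h1)
  linarith

end agentSchedule

/-! ### The principals' payment schedule above the budget -/

section principalSchedule

/-- The outcomes with payment above `b` obtained by principals of valuation at most `x`, together
with the base outcome `(a₀, b)` at valuation `l`. -/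
def principalMenu (M : Mechanism β) (b l a₀ x : ℝ) : Set Outcome :=
  {z | z = (a₀, b) ∨ (l < x ∧ ∃ v ∈ typeSpace β, b < M.p v ∧ v.2 ≤ x ∧ z = M.outcome v)}

/-- The highest payment in the principals' menu. -/
noncomputable def principalPayment (M : Mechanism β) (b l a₀ x : ℝ) : ℝ :=
  sSup (Prod.snd '' M.principalMenu b l a₀ x)

/-- The highest allocation in the principals' menu. -/
noncomputable def principalAllocation (M : Mechanism β) (b l a₀ x : ℝ) : ℝ :=
  sSup (Prod.fst '' M.principalMenu b l a₀ x)

variable {l a₀ : ℝ}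

/-- The base outcome `(a₀, b)` lies below all outcomes with payment above `b`. -/
structure IsPrincipalBase (M : Mechanism β) (b l a₀ : ℝ) : Prop where
  nonneg : 0 ≤ l
  le_one : a₀ ≤ 1
  le : ∀ v ∈ typeSpace β, b < M.p v → l ≤ v.2
  allocation_le : ∀ v ∈ typeSpace β, b < M.p v → a₀ ≤ M.q v
  payment_le : ∀ v ∈ typeSpace β, b < M.p v → M.p v - b ≤ v.2 * (M.q v - a₀)

theorem base_mem_principalMenu (x : ℝ) : (a₀, b) ∈ M.principalMenu b l a₀ x := Or.inl rfl

/-- This is the purpose of the clause `l < x`: types with `v.2 = l` may already pay more than `b`,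
yet the schedule must start exactly at the base outcome. -/
theorem principalMenu_self : M.principalMenu b l a₀ l = {(a₀, b)} := by
  ext z; simp [principalMenu]

theorem principalPayment_self : M.principalPayment b l a₀ l = b := by
  simp [principalPayment, principalMenu_self]

theorem principalAllocation_self : M.principalAllocation b l a₀ l = a₀ := by
  simp [principalAllocation, principalMenu_self]

theorem principalMenu_mono {x y : ℝ} (h : x ≤ y) :
    M.principalMenu b l a₀ x ⊆ M.principalMenu b l a₀ y := by
  rintro z (hz | ⟨hx, v, hv, hp, hv2, rfl⟩)
  · exact Or.inl hz
  · exact Or.inr ⟨hx.trans_le h, v, hv, hp, hv2.trans h, rfl⟩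

theorem IsPrincipalBase.bddAbove_fst
    (hbase : IsPrincipalBase M b l a₀) (x : ℝ) :
    BddAbove (Prod.fst '' M.principalMenu b l a₀ x) := by
  refine ⟨1, ?_⟩
  rintro _ ⟨z, hz | ⟨-, v, hv, -, -, rfl⟩, rfl⟩
  · rw [hz]; exact hbase.le_one
  · exact (M.q_mem v hv).2

theorem IsPrincipalBase.bddAbove_snd
    (hbase : IsPrincipalBase M b l a₀) (x : ℝ) :
    BddAbove (Prod.snd '' M.principalMenu b l a₀ x) := by
  refine ⟨b + |β| * (1 - a₀), ?_⟩
  have h0 : 0 ≤ |β| * (1 - a₀) := mul_nonneg (abs_nonneg _) (by linarith [hbase.le_one])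
  rintro _ ⟨z, hz | ⟨-, v, hv, hp, -, rfl⟩, rfl⟩
  · rw [hz]; simpa using h0
  · have h1 := hbase.payment_le v hv hp
    have h2 : v.2 * (M.q v - a₀) ≤ |β| * (1 - a₀) :=
      mul_le_mul (hv.2.1.2.trans (le_abs_self β)) (by linarith [(M.q_mem v hv).2])
        (by linarith [hbase.allocation_le v hv hp]) (abs_nonneg _)
    simp only [outcome]
    linarith

theorem IsPrincipalBase.le_allocation
    (hbase : IsPrincipalBase M b l a₀) {x : ℝ} {z : Outcome}
    (hz : z ∈ M.principalMenu b l a₀ x) : z.1 ≤ M.principalAllocation b l a₀ x :=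
  le_csSup (hbase.bddAbove_fst x) ⟨z, hz, rfl⟩

theorem IsPrincipalBase.le_payment
    (hbase : IsPrincipalBase M b l a₀) {x : ℝ} {z : Outcome}
    (hz : z ∈ M.principalMenu b l a₀ x) : z.2 ≤ M.principalPayment b l a₀ x :=
  le_csSup (hbase.bddAbove_snd x) ⟨z, hz, rfl⟩

theorem IsPrincipalBase.allocation_mono
    (hbase : IsPrincipalBase M b l a₀) {x y : ℝ} (h : x ≤ y) :
    M.principalAllocation b l a₀ x ≤ M.principalAllocation b l a₀ y :=
  csSup_le_csSup (hbase.bddAbove_fst y) ⟨_, _, base_mem_principalMenu x, rfl⟩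
    (Set.image_mono (principalMenu_mono h))

theorem IsPrincipalBase.allocation_le_one
    (hbase : IsPrincipalBase M b l a₀) (x : ℝ) : M.principalAllocation b l a₀ x ≤ 1 := by
  refine csSup_le ⟨_, _, base_mem_principalMenu x, rfl⟩ ?_
  rintro _ ⟨z, hz | ⟨-, v, hv, -, -, rfl⟩, rfl⟩
  · rw [hz]; exact hbase.le_one
  · exact (M.q_mem v hv).2

/-- Any outcome new to the menu at `y` satisfies the incentive inequality against each outcome of
the menu at `x`: by revealed preference, or by the base property for `(a₀, b)`. These inequalities
pass to the suprema, which are needed because types with equal `v.2` may get different outcomes. -/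
theorem IsPrincipalBase.payment_sub_le
    (hbase : IsPrincipalBase M b l a₀) (hIC : M.IC b) {x y : ℝ} (hx : l ≤ x) (hxy : x < y) :
    M.principalPayment b l a₀ y - M.principalPayment b l a₀ x ≤
      y * (M.principalAllocation b l a₀ y - M.principalAllocation b l a₀ x) := by
  have hy : 0 < y := by linarith [hbase.nonneg]
  have hmono := mul_nonneg hy.le (sub_nonneg.2 (hbase.allocation_mono hxy.le))
  suffices M.principalPayment b l a₀ y ≤ M.principalPayment b l a₀ x +
      y * (M.principalAllocation b l a₀ y - M.principalAllocation b l a₀ x) by linarith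
  have hbx := hbase.le_payment (base_mem_principalMenu (M := M) (b := b) (l := l) (a₀ := a₀) x)
  refine csSup_le ⟨_, _, base_mem_principalMenu y, rfl⟩ ?_
  rintro _ ⟨z, hz, rfl⟩
  by_cases hzx : z ∈ M.principalMenu b l a₀ x
  · linarith [hbase.le_payment hzx]
  have hzy := hbase.le_allocation hz
  rcases hz with hz | ⟨-, v, hv, hp, hvy, rfl⟩
  · exact absurd (Or.inl hz) hzx
  -- Solved for the allocation at `x`, so that a supremum over the old outcomes can be taken.
  suffices M.principalAllocation b l a₀ x ≤ (M.principalPayment b l a₀ x +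
      y * M.principalAllocation b l a₀ y - M.p v) / y by
    rw [le_div_iff₀ hy] at this
    simp only [outcome]
    linarith
  refine csSup_le ⟨_, _, base_mem_principalMenu x, rfl⟩ ?_
  rintro _ ⟨z', hz', rfl⟩
  rw [le_div_iff₀ hy]
  have hz'x := hbase.le_payment hz'
  have key : z'.1 ≤ M.q v ∧ M.p v - z'.2 ≤ v.2 * (M.q v - z'.1) := by
    rcases hz' with hz' | ⟨hlx, v', hv', hp', hv'x, rfl⟩
    · rw [hz']
      exact ⟨hbase.allocation_le v hv hp, hbase.payment_le v hv hp⟩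
    · have hxv : x < v.2 := by
        by_contra hle
        exact hzx (Or.inr ⟨hlx, v, hv, hp, not_lt.1 hle, rfl⟩)
      have hc' := hIC.outcome_mem_of_lt_payment hv' hp'
      have hc := hIC.outcome_mem_of_lt_payment hv hp
      exact ⟨choice_allocation_mono hc' hc (hv'x.trans_lt hxv), (choice_payment_bounds hc' hc).2⟩
  have h1 : v.2 * (M.q v - z'.1) ≤ y * (M.q v - z'.1) :=
    mul_le_mul_of_nonneg_right hvy (sub_nonneg.2 key.1)
  have h2 : y * M.q v ≤ y * M.principalAllocation b l a₀ y := mul_le_mul_of_nonneg_left hzy hy.le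
  linarith [key.2]

theorem IsPrincipalBase.payment_le_principalPayment
    (hbase : IsPrincipalBase M b l a₀) {y : ℝ} {v : ℝ × ℝ} (hv : v ∈ typeSpace β)
    (hvy : v.2 ≤ y) (hy : l < y) : M.p v ≤ M.principalPayment b l a₀ y := by
  by_cases hp : b < M.p v
  · exact hbase.le_payment (z := M.outcome v) (Or.inr ⟨hy, v, hv, hp, hvy, rfl⟩)
  · exact (not_lt.1 hp).trans (hbase.le_payment (base_mem_principalMenu y))

/-- Payments of types above the cutoff `l` are dominated by the step function of the principals'
schedule along any grid, if `l < β`. -/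
theorem IsPrincipalBase.payment_le_step
    (hbase : IsPrincipalBase M b l a₀) (hl : l < β) {n : ℕ} (hn : 0 < n) {v : ℝ × ℝ}
    (hv : v ∈ typeSpace β) (hlv : l ≤ v.2) :
    M.p v ≤ b + ∑ i ∈ Finset.range n, if grid l β n i ≤ v.2 then
      M.principalPayment b l a₀ (grid l β n (i + 1)) -
        M.principalPayment b l a₀ (grid l β n i) else 0 := by
  have h := le_add_sum_step (x := grid l β n) (n := n)
    (Q := fun i => M.principalPayment b l a₀ (grid l β n i)) (grid_mono hl.le n)
    (c := M.p v) (y := v.2) (by rwa [grid_zero])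
    (fun k _ hk hk' => hbase.payment_le_principalPayment hv hk'.le (hlv.trans_lt hk'))
    (fun _ => hbase.payment_le_principalPayment hv (by rw [grid_self _ _ hn]; exact hv.2.1.2)
      (by rwa [grid_self _ _ hn]))
  rwa [grid_zero, principalPayment_self] at h

/-- The additional revenue of the principals' schedule is at most that of a single price. -/
theorem IsPrincipalBase.eventually_principalSchedule_le
    (hbase : IsPrincipalBase M b l a₀) (hIC : M.IC b) (hf : IsJointDensity β f)
    (hl : l ≤ β) {m : ℝ} (hm : ∀ x ∈ Set.Icc l β, x * tail β f Prod.snd x ≤ m) {ε : ℝ}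
    (hε : 0 < ε) :
    ∀ᶠ n : ℕ in atTop, ∑ i ∈ Finset.range n,
      (M.principalPayment b l a₀ (grid l β n (i + 1)) -
        M.principalPayment b l a₀ (grid l β n i)) * tail β f Prod.snd (grid l β n i) ≤
      (1 - a₀) * m + ε := by
  have hm0 : 0 ≤ m :=
    (mul_nonneg hbase.nonneg (tail_nonneg hf l)).trans (hm l ⟨le_rfl, hl⟩)
  filter_upwards [eventually_sum_grid_le_mul (q := M.principalAllocation b l a₀) hl
    (tail_le_one hf quasiMeasurePreserving_snd) (tail_nonneg hf)
    (fun x y _ hxy _ => hbase.allocation_mono hxy.le)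
    (fun x y hx hxy _ => hbase.payment_sub_le hIC hx hxy) hm hε] with n hn
  refine hn.trans ?_
  rw [principalAllocation_self]
  have := mul_le_mul_of_nonneg_right (hbase.allocation_le_one β) hm0
  linarith

end principalSchedule

/-! ### Revenue bounds for arbitrary mechanisms -/

section revenue

theorem exists_best_principal_price (hf : IsJointDensity β f) {l : ℝ} (hl : l ≤ β) :
    ∃ κ ∈ Set.Icc l β, ∀ x ∈ Set.Icc l β, x * tail β f Prod.snd x ≤ κ * tail β f Prod.snd κ :=
  isCompact_Icc.exists_isMaxOn (Set.nonempty_Icc.2 hl)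
    (continuous_id.mul (continuous_tail hf quasiMeasurePreserving_snd)).continuousOn

theorem revenue_nonpos (hf : IsJointDensity β f) (hp : ∀ v ∈ typeSpace β, M.p v ≤ 0) :
    M.revenue f ≤ 0 := by
  refine setIntegral_nonpos (measurableSet_typeSpace β) fun v hv => ?_
  exact mul_nonpos_of_nonpos_of_nonneg (hp v hv) (hf.nonneg v hv)

/-- Within the budget, a price posted to the agent is best. -/
theorem IC.exists_post1_bound (hIC : M.IC b) (hIR : M.IR) (hb : 0 ≤ b) (hβ : 0 < β)
    (hf : IsJointDensity β f)
    (hconc : ConcaveOn ℝ (Set.Icc 0 β) (fun x => x * tail β f Prod.fst x))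
    (hpf : IntegrableOn (fun v => M.p v * f v) (typeSpace β))
    (hp : ∀ v ∈ typeSpace β, M.p v ≤ b) :
    ∃ κ ∈ Set.Icc 0 (min b β), M.revenue f ≤ κ * tail β f Prod.fst κ := by
  have hββ : β ∈ Set.Icc 0 β := ⟨hβ.le, le_rfl⟩
  have huβ := hIC.agentUtility_nonneg hIR hb hββ
  -- An allocation of at most one that leaves valuation `β` its utility costs at most `β -
  -- M.agentUtility β`. This cap on `t` keeps the completed allocation `(t + M.agentUtility β) / β`
  -- at most one, so Jensen's price is at least `t` and posting `t` earns no less.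
  obtain ⟨t, ht⟩ : ∃ t, t = min b (β - M.agentUtility β) := ⟨_, rfl⟩
  have htb : t ≤ b := ht ▸ min_le_left _ _
  have htu : t ≤ β - M.agentUtility β := ht ▸ min_le_right _ _
  have hpt : ∀ v ∈ typeSpace β, M.p v ≤ t := by
    intro v hv
    rw [ht]
    refine le_min (hp v hv) ?_
    have h := hIC.payoff_le_agentUtility hIR hb hββ (z := M.outcome v)
      ⟨outcome_mem_range hv, hp v hv⟩
    have hc := hIC.outcome_mem_of_payment_le hIR hb hv (hp v hv)
    have hcβ := hIC.outcome_mk_zero_mem hIR hb hββ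
    have hq := (M.q_mem v hv).2
    have hqβ := (M.q_mem _ (mk_zero_mem_typeSpace hββ)).2
    have hu : M.agentUtility β = β * M.q (β, 0) - M.p (β, 0) := rfl
    rcases hv.1.2.lt_or_eq with hlt | heq
    · have := choice_payment_mono hc hcβ hv.1.1 hlt
      simp only [outcome] at this
      nlinarith
    · have := (choice_payment_bounds hcβ hc).2
      simp only [outcome, heq] at this
      nlinarith
  rcases le_or_gt t 0 with ht0 | ht0
  · refine ⟨0, ⟨le_rfl, le_min hb hβ.le⟩, ?_⟩
    rw [zero_mul]
    exact revenue_nonpos hf fun v hv => (hpt v hv).trans ht0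
  have hpβ := hpt _ (mk_zero_mem_typeSpace hββ)
  refine ⟨t, ⟨ht0.le, le_min htb (by linarith)⟩, le_of_forall_pos_le_add fun ε hε => ?_⟩
  have hq1 : (t + M.agentUtility β) / β ≤ 1 := (div_le_one hβ).2 (by linarith)
  have hG := mul_le_mul_of_nonneg_left (tail_antitone hf quasiMeasurePreserving_fst
    (show t ≤ t / ((t + M.agentUtility β) / β) from
      le_div_self ht0.le (by positivity) hq1)) ht0.le
  obtain ⟨n, hn, hn0⟩ := ((hIC.eventually_agentSchedule_le hIR hb hf hconc hβ le_rfl hpβ ht0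
    hε).and (eventually_gt_atTop 0)).exists
  have h := revenue_le_of_payment_le_step hf hpf (M.agentPayment β t 0) (Finset.range n)
    (∅ : Finset ℕ) (fun i => M.agentPayment β t (grid 0 β n (i + 1)) -
      M.agentPayment β t (grid 0 β n i)) (grid 0 β n) 0 0 (fun v hv _ => by
    have := le_add_sum_step (x := grid 0 β n) (n := n)
      (Q := fun i => M.agentPayment β t (grid 0 β n i)) (grid_mono hβ.le n)
      (c := M.p v) (y := v.1) (by rw [grid_zero]; exact hv.1.1)
      (fun k hk _ hk' => hIC.payment_le_agentPayment hIR hb le_rfl hpβ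
        (grid_mem hβ.le hn0 (Nat.succ_le_of_lt hk)).2 hv (hp v hv) hk')
      (fun _ => by rw [grid_self _ _ hn0]; simpa [agentPayment] using hpt v hv)
    simpa [grid_zero] using this)
  simp only [Finset.sum_empty, add_zero] at h
  linarith

/-- The base of the principals' schedule when some payments exceed the budget. -/
theorem IC.isPrincipalBase_sInf (hIC : M.IC b) (hIR : M.IR) (hb : 0 < b)
    (hex : ∃ v ∈ typeSpace β, b < M.p v) :
    ∃ l, b ≤ l ∧ l ≤ β ∧ IsPrincipalBase M b l ((b + M.agentUtility l) / l) := by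
  let E : Set ℝ := {e | ∃ v ∈ typeSpace β, b < M.p v ∧ v.2 = e}
  have hEne : E.Nonempty := let ⟨v, hv, hp⟩ := hex; ⟨v.2, v, hv, hp, rfl⟩
  have hu := fun v (hv : v ∈ typeSpace β) (hp : b < M.p v) =>
    hIC.agentUtility_le_of_lt_payment hv hp hIR hb.le
  have hbE : ∀ e ∈ E, b ≤ e := by
    rintro _ ⟨v, hv, hp, rfl⟩
    have h1 := hu v hv hp
    have h2 := hIC.agentUtility_nonneg hIR hb.le hv.2.1
    have h3 := mul_le_of_le_one_right hv.2.1.1 (M.q_mem v hv).2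
    linarith
  have hEb : BddBelow E := ⟨b, hbE⟩
  obtain ⟨l, hl⟩ : ∃ l, l = sInf E := ⟨_, rfl⟩
  have hlE : ∀ e ∈ E, l ≤ e := fun e he => hl ▸ csInf_le hEb he
  have hbl : b ≤ l := hl ▸ le_csInf hEne hbE
  have hl0 : 0 < l := hb.trans_le hbl
  have hlβ : l ≤ β := by
    obtain ⟨v, hv, hp⟩ := hex
    exact (hlE _ ⟨v, hv, hp, rfl⟩).trans hv.2.1.2
  have hlmem : l ∈ Set.Icc 0 β := ⟨hl0.le, hlβ⟩
  have hul := hIC.agentUtility_nonneg hIR hb.le hlmem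
  -- The outcome `(a, b)` gives valuation `l` exactly its budget utility.
  obtain ⟨a, ha⟩ : ∃ a, a = (b + M.agentUtility l) / l := ⟨_, rfl⟩
  have hla : l * a = b + M.agentUtility l := by rw [ha]; field_simp
  have ha0 : 0 < a := by rw [ha]; positivity
  have hmono : ∀ v ∈ typeSpace β, b < M.p v → M.agentUtility l ≤ M.agentUtility v.2 :=
    fun v hv hp => hIC.agentUtility_mono hIR hb.le hlmem hv.2.1 (hlE _ ⟨v, hv, hp, rfl⟩)
  have hself : ∀ v ∈ typeSpace β, b < M.p v → b + M.agentUtility l ≤ v.2 * M.q v :=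
    fun v hv hp => by linarith [hu v hv hp, hmono v hv hp]
  have halloc : ∀ v ∈ typeSpace β, b < M.p v → a ≤ M.q v := by
    intro v hv hp
    have hv0 : 0 < v.2 := hb.trans_le (hbE _ ⟨v, hv, hp, rfl⟩)
    have hq0 : 0 < M.q v := pos_of_mul_pos_right ((by linarith : 0 < b + M.agentUtility l).trans_le
      (hself v hv hp)) hv0.le
    -- The infimum need not be attained. With `M.agentUtility l` held fixed, the claim is a lower
    -- bound on `l`, so it suffices to prove it for the value `v'.2` of every type `v'` paying above
    -- `b`. The payment inequality below is treated alike.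
    rw [ha, div_le_iff₀ hl0, ← div_le_iff₀' hq0, hl]
    refine le_csInf hEne ?_
    rintro _ ⟨v', hv', hp', rfl⟩
    rw [← hl, div_le_iff₀' hq0, mul_comm]
    rcases le_or_gt v.2 v'.2 with hle | hlt
    · exact (hself v hv hp).trans (mul_le_mul_of_nonneg_right hle hq0.le)
    · have h1 := choice_allocation_mono (hIC.outcome_mem_of_lt_payment hv' hp')
        (hIC.outcome_mem_of_lt_payment hv hp) hlt
      exact (hself v' hv' hp').trans (mul_le_mul_of_nonneg_left h1 hv'.2.1.1)
  refine ⟨l, hbl, hlβ, ?_⟩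
  rw [← ha]
  refine ⟨hl0.le, ?_, fun v hv hp => hlE _ ⟨v, hv, hp, rfl⟩, halloc, ?_⟩
  · obtain ⟨v, hv, hp⟩ := hex
    exact (halloc v hv hp).trans (M.q_mem v hv).2
  · intro v hv hp
    suffices v.2 - (v.2 * M.q v - M.p v - M.agentUtility l) / a ≤ l by
      rw [sub_le_comm, le_div_iff₀ ha0] at this
      linarith
    rw [hl]
    refine le_csInf hEne ?_
    rintro _ ⟨v', hv', hp', rfl⟩
    rw [← hl, sub_le_comm, le_div_iff₀ ha0]
    rcases le_or_gt v.2 v'.2 with hle | hlt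
    · have := mul_nonneg (sub_nonneg.2 hle) ha0.le
      linarith [hu v hv hp, hmono v hv hp]
    · have h1 := (choice_payment_bounds (hIC.outcome_mem_of_lt_payment hv' hp')
        (hIC.outcome_mem_of_lt_payment hv hp)).2
      simp only [outcome] at h1
      have h2 := mul_le_mul_of_nonneg_left (halloc v' hv' hp') (sub_nonneg.2 hlt.le)
      linarith [hu v' hv' hp', hmono v' hv' hp']

/-- When some payments exceed a positive budget, a mechanism with one cutoff for the agent and one
for the principal is at least as good. -/
theorem IC.exists_post2_bound (hIC : M.IC b) (hIR : M.IR) (hb : 0 < b)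
    (hf : IsJointDensity β f)
    (hconc : ConcaveOn ℝ (Set.Icc 0 β) (fun x => x * tail β f Prod.fst x))
    (hpf : IntegrableOn (fun v => M.p v * f v) (typeSpace β))
    (hex : ∃ v ∈ typeSpace β, b < M.p v) :
    ∃ κ₁ κ₂, b ≤ κ₁ ∧ κ₁ ≤ κ₂ ∧ κ₂ ≤ β ∧ M.revenue f ≤
      b * tail β f Prod.fst κ₁ + κ₂ * (1 - b / κ₁) * tail β f Prod.snd κ₂ := by
  obtain ⟨l, hbl, hlβ, hbase⟩ := hIC.isPrincipalBase_sInf hIR hb hex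
  have hl0 : 0 < l := hb.trans_le hbl
  have hlmem : l ∈ Set.Icc 0 β := ⟨hl0.le, hlβ⟩
  have hul := hIC.agentUtility_nonneg hIR hb.le hlmem
  obtain ⟨κ₂, hκ₂, hmax⟩ := exists_best_principal_price hf hlβ
  obtain ⟨a, ha⟩ : ∃ a, a = (b + M.agentUtility l) / l := ⟨_, rfl⟩
  rw [← ha] at hbase
  have hla : l * a = b + M.agentUtility l := by rw [ha]; field_simp
  have ha0 : 0 < a := by rw [ha]; positivity
  have hba : b / (b / a) = a := by field_simp
  have hκl : b / a ≤ l := (div_le_iff₀ ha0).2 (by linarith)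
  -- The price `b / a` is the one Jensen produces; it sells exactly the share `a`.
  refine ⟨b / a, κ₂, le_div_self hb.le ha0 hbase.le_one, hκl.trans hκ₂.1, hκ₂.2, ?_⟩
  rw [hba]
  have hpl : M.p (l, 0) ≤ b := (hIC.outcome_mk_zero_mem hIR hb.le hlmem).1.2
  have hcheap : ∀ v ∈ typeSpace β, v.2 < l → M.p v ≤ b := fun v hv hvl =>
    not_lt.1 fun hp => absurd (hbase.le v hv hp) (not_le.2 hvl)
  refine le_of_forall_pos_le_add fun ε hε => ?_
  obtain ⟨n, ⟨hn, hn'⟩, hn0⟩ := (((hIC.eventually_agentSchedule_le hIR hb.le hf hconc hl0 hlβ hpl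
    hb (half_pos hε)).and (hbase.eventually_principalSchedule_le hIC hf hlβ hmax
    (half_pos hε))).and (eventually_gt_atTop 0)).exists
  rw [← ha] at hn
  have h := revenue_le_of_payment_le_step hf hpf (M.agentPayment l b 0) (Finset.range n)
    (Finset.range n) (fun i => M.agentPayment l b (grid 0 l n (i + 1)) -
      M.agentPayment l b (grid 0 l n i)) (grid 0 l n)
    (fun i => M.principalPayment b l a (grid l β n (i + 1)) -
      M.principalPayment b l a (grid l β n i)) (grid l β n) (fun v hv hvβ => by
    have hstep := fun (c : ℝ) => le_add_sum_step (x := grid 0 l n) (n := n)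
      (Q := fun i => M.agentPayment l b (grid 0 l n i)) (grid_mono hl0.le n)
      (c := c) (y := v.1) (by rw [grid_zero]; exact hv.1.1)
    simp only [grid_zero, grid_self _ _ hn0] at hstep
    have hlb : M.agentPayment l b l = b := by simp [agentPayment]
    rw [hlb] at hstep
    -- Below `l` payments are within the budget and follow the agents' schedule. Otherwise `v.1 ≥
    -- v.2 ≥ l`, so that schedule has reached `b` and the principals' steps cover the excess; `v.2 <
    -- β` then gives a nondegenerate grid on `[l, β]`.
    rcases lt_or_ge v.2 l with hvl | hlv
    · have h0 : ∀ j ∈ Finset.range n, (if grid l β n j ≤ v.2 then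
          M.principalPayment b l a (grid l β n (j + 1)) -
            M.principalPayment b l a (grid l β n j) else 0) = 0 := fun j hj =>
        if_neg (not_le.2 (hvl.trans_le (grid_mem hlβ hn0 (Finset.mem_range.1 hj).le).1))
      rw [Finset.sum_eq_zero h0, add_zero]
      exact hstep _ (fun k hk _ hk' => hIC.payment_le_agentPayment hIR hb.le hlβ hpl
        (grid_mem hl0.le hn0 (Nat.succ_le_of_lt hk)).2 hv (hcheap v hv hvl) hk')
        (fun _ => hcheap v hv hvl)
    · have h1 := hbase.payment_le_step (hlv.trans_lt hvβ) hn0 hv hlv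
      have h2 := hstep b (fun k hk _ hk' => absurd ((hlv.trans hv.2.2).trans_lt hk')
        (not_lt.2 (grid_mem hl0.le hn0 (Nat.succ_le_of_lt hk)).2)) (fun _ => le_rfl)
      linarith)
  linarith

/-- Without any budget, only the principal can be charged. -/
theorem IC.exists_principal_price_bound (hIC : M.IC 0) (hIR : M.IR) (hβ : 0 < β)
    (hf : IsJointDensity β f)
    (hpf : IntegrableOn (fun v => M.p v * f v) (typeSpace β)) :
    ∃ κ ∈ Set.Icc 0 β, M.revenue f ≤ κ * tail β f Prod.snd κ := by
  -- The outcome `(0, 0)` serves as base, which avoids dividing by an infimum `l` that could be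
  -- zero.
  have hbase : IsPrincipalBase M 0 0 0 := by
    refine ⟨le_rfl, zero_le_one, fun v hv _ => hv.2.1.1, fun v hv _ => (M.q_mem v hv).1,
      fun v hv hp => ?_⟩
    have h1 := hIC.agentUtility_le_of_lt_payment hv hp hIR le_rfl
    have h2 := hIC.agentUtility_nonneg hIR le_rfl hv.2.1
    linarith
  obtain ⟨κ, hκ, hmax⟩ := exists_best_principal_price hf hβ.le
  refine ⟨κ, hκ, le_of_forall_pos_le_add fun ε hε => ?_⟩
  obtain ⟨n, hn, hn0⟩ := ((hbase.eventually_principalSchedule_le hIC hf hβ.le hmax hε).and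
    (eventually_gt_atTop 0)).exists
  have h := revenue_le_of_payment_le_step hf hpf 0 (∅ : Finset ℕ) (Finset.range n) 0 0
    (fun i => M.principalPayment 0 0 0 (grid 0 β n (i + 1)) -
      M.principalPayment 0 0 0 (grid 0 β n i)) (grid 0 β n) (fun v hv _ => by
    simpa using hbase.payment_le_step hβ hn0 hv hv.2.1.1)
  simp only [Finset.sum_empty, zero_add] at h
  linarith

end revenue

/-! ### Existence of an optimal POST mechanism -/

section optimality

/-- A payment rule that is not integrable has revenue zero by convention, hence the requirement of
nonnegative revenue. -/
theorem isOptimal_of_forall_integrable {M : Mechanism β} (hIC : M.IC b) (hIR : M.IR)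
    (hpf : IntegrableOn (fun v => M.p v * f v) (typeSpace β)) (h0 : 0 ≤ M.revenue f)
    (h : ∀ M' : Mechanism β, M'.IC b → M'.IR →
      IntegrableOn (fun v => M'.p v * f v) (typeSpace β) → M'.revenue f ≤ M.revenue f) :
    M.IsOptimal b f := by
  refine ⟨hIC, hIR, hpf, fun M' hIC' hIR' => ?_⟩
  by_cases hpf' : IntegrableOn (fun v => M'.p v * f v) (typeSpace β)
  · exact h M' hIC' hIR' hpf'
  · exact (integral_undef hpf').trans_le h0

theorem exists_isOptimal_of_zero_budget (hβ : 0 < β) (hf : IsJointDensity β f) :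
    ∃ M : Mechanism β, M.IsOptimal 0 f ∧ M.IsPost2 0 := by
  obtain ⟨κ, hκ, hκ0, hmax⟩ : ∃ κ ∈ Set.Icc 0 β, 0 < κ ∧
      ∀ x ∈ Set.Icc 0 β, x * tail β f Prod.snd x ≤ κ * tail β f Prod.snd κ := by
    obtain ⟨κ, hκ, hmax⟩ := exists_best_principal_price hf hβ.le
    -- POST-2 needs a positive cutoff. If the maximiser is zero, the maximal revenue is zero and `β`
    -- does as well.
    rcases hκ.1.eq_or_lt with h0 | h0
    · refine ⟨β, ⟨hβ.le, le_rfl⟩, hβ, fun x hx => (hmax x hx).trans ?_⟩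
      rw [← h0, zero_mul]
      exact mul_nonneg hβ.le (tail_nonneg hf _)
    · exact ⟨κ, hκ, h0, hmax⟩
  obtain ⟨hpf, hrev⟩ := post2_revenue (b := 0) hf le_rfl hκ0 hκ.1 le_rfl
  simp only [zero_mul, zero_div, sub_zero, mul_one, zero_add] at hrev
  refine ⟨post2 β κ le_rfl hκ0 hκ.1, isOptimal_of_forall_integrable
    (ic_post2 le_rfl hκ0 hκ.1 hβ.le le_rfl) (ir_post2 le_rfl hκ0 hκ.1 hβ.le) hpf ?_ ?_,
    isPost2_post2 le_rfl hκ0 hκ.1 le_rfl hκ.2⟩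
  · rw [hrev]
    exact mul_nonneg hκ0.le (tail_nonneg hf _)
  · intro M' hIC' hIR' hpf'
    obtain ⟨x, hx, hle⟩ := hIC'.exists_principal_price_bound hIR' hβ hf hpf'
    rw [hrev]
    exact hle.trans (hmax x hx)

theorem exists_isOptimal_of_pos_budget (hβ : 0 < β) (hb : 0 < b) (hf : IsJointDensity β f)
    (hconc : ConcaveOn ℝ (Set.Icc 0 β) (fun x => x * tail β f Prod.fst x)) :
    ∃ M : Mechanism β, M.IsOptimal b f ∧ (M.IsPost1 b ∨ M.IsPost2 b) := by
  have hc1 := continuous_tail hf quasiMeasurePreserving_fst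
  have hc2 := continuous_tail hf quasiMeasurePreserving_snd
  obtain ⟨κ, hκ, hmax⟩ : ∃ κ ∈ Set.Icc 0 (min b β), ∀ x ∈ Set.Icc 0 (min b β),
      x * tail β f Prod.fst x ≤ κ * tail β f Prod.fst κ :=
    isCompact_Icc.exists_isMaxOn (Set.nonempty_Icc.2 (le_min hb.le hβ.le))
      (continuous_id.mul hc1).continuousOn
  have hκb : κ ∈ Set.Icc 0 b := ⟨hκ.1, hκ.2.trans (min_le_left _ _)⟩
  obtain ⟨hpf1, hrev1⟩ := post1_revenue hf κ
  have hrev1_nonneg : 0 ≤ κ * tail β f Prod.fst κ := mul_nonneg hκ.1 (tail_nonneg hf _)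
  let g : ℝ × ℝ → ℝ := fun k =>
    b * tail β f Prod.fst k.1 + k.2 * (1 - b / k.1) * tail β f Prod.snd k.2
  -- `K` is empty when `b > β`; the posted price is then optimal.
  let K : Set (ℝ × ℝ) := Set.Icc b β ×ˢ Set.Icc b β ∩ {k | k.1 ≤ k.2}
  -- either some two-cutoff mechanism beats all mechanisms, or the best posted price does
  by_cases hK : ∃ k ∈ K, κ * tail β f Prod.fst κ ≤ g k
  · obtain ⟨k₀, hk₀, hgk₀⟩ := hK
    have hKc : IsCompact K := (isCompact_Icc.prod isCompact_Icc).inter_right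
      (isClosed_le continuous_fst continuous_snd)
    have hgc : ContinuousOn g K := by
      have hdiv : ContinuousOn (fun k : ℝ × ℝ => b / k.1) K :=
        continuousOn_const.div continuous_fst.continuousOn fun k hk => (hb.trans_le hk.1.1.1).ne'
      exact (continuous_const.mul (hc1.comp continuous_fst)).continuousOn.add
        ((continuous_snd.continuousOn.mul (continuousOn_const.sub hdiv)).mul
          (hc2.comp continuous_snd).continuousOn)
    obtain ⟨⟨κ₁, κ₂⟩, ⟨⟨h1, h2⟩, h12⟩, hkmax⟩ := hKc.exists_isMaxOn ⟨k₀, hk₀⟩ hgc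
    simp only at h1 h2
    replace h12 : κ₁ ≤ κ₂ := h12
    have h0 : 0 < κ₁ := hb.trans_le h1.1
    have hbest : κ * tail β f Prod.fst κ ≤ g (κ₁, κ₂) := hgk₀.trans (hkmax hk₀)
    obtain ⟨hpf, hrev⟩ := post2_revenue hf hb.le h0 h1.1 h12
    refine ⟨post2 β κ₂ hb.le h0 h1.1, isOptimal_of_forall_integrable
      (ic_post2 hb.le h0 h1.1 hβ.le h12) (ir_post2 hb.le h0 h1.1 hβ.le) hpf ?_ ?_,
      Or.inr (isPost2_post2 hb.le h0 h1.1 h12 h2.2)⟩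
    · rw [hrev]
      exact hrev1_nonneg.trans hbest
    · intro M' hIC' hIR' hpf'
      rw [hrev]
      by_cases hex : ∃ v ∈ typeSpace β, b < M'.p v
      · obtain ⟨x, y, hx, hxy, hy, hle⟩ :=
          hIC'.exists_post2_bound hIR' hb hf hconc hpf' hex
        exact hle.trans (hkmax (a := (x, y)) ⟨⟨⟨hx, hxy.trans hy⟩, ⟨hx.trans hxy, hy⟩⟩, hxy⟩)
      · push Not at hex
        obtain ⟨x, hx, hle⟩ := hIC'.exists_post1_bound hIR' hb.le hβ hf hconc hpf' hex
        exact (hle.trans (hmax x hx)).trans hbest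
  · push Not at hK
    refine ⟨post1 β κ, isOptimal_of_forall_integrable (ic_post1 hκb) (ir_post1 hβ.le hκ.1) hpf1
      (hrev1 ▸ hrev1_nonneg) ?_, Or.inl (isPost1_post1 hκb)⟩
    intro M' hIC' hIR' hpf'
    rw [hrev1]
    by_cases hex : ∃ v ∈ typeSpace β, b < M'.p v
    · obtain ⟨x, y, hx, hxy, hy, hle⟩ := hIC'.exists_post2_bound hIR' hb hf hconc hpf' hex
      exact hle.trans (hK (x, y) ⟨⟨⟨hx, hxy.trans hy⟩, ⟨hx.trans hxy, hy⟩⟩, hxy⟩).le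
    · push Not at hex
      obtain ⟨x, hx, hle⟩ := hIC'.exists_post1_bound hIR' hb.le hβ hf hconc hpf' hex
      exact hle.trans (hmax x hx)

end optimality

end Mechanism

end PrincipalAgent

theorem mainTheorem1 (β : ℝ) (hβ : 0 < β) (b : ℝ) (hb : 0 ≤ b)
    (f : ℝ × ℝ → ℝ) (hf : PrincipalAgent.IsJointDensity β f)
    (hconc : StrictConcaveOn ℝ (Set.Icc 0 β)
      (fun x => x * (1 - PrincipalAgent.marginalCDF₁ β f x))) :
    ∃ M : PrincipalAgent.Mechanism β,
      M.IsOptimal b f ∧ (M.IsPost1 b ∨ M.IsPost2 b) := by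
  simp only [PrincipalAgent.one_sub_marginalCDF₁ hf] at hconc
  rcases hb.eq_or_lt with rfl | hb
  · obtain ⟨M, hM, hM2⟩ := PrincipalAgent.Mechanism.exists_isOptimal_of_zero_budget hβ hf
    exact ⟨M, hM, Or.inr hM2⟩
  · exact PrincipalAgent.Mechanism.exists_isOptimal_of_pos_budget hβ hb hf hconc.concaveOn
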